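/- Let $n\ge 1$, $\beta>0$, $b_0>0$, and let $h(x)=e^{-\beta|x|^2}$ be the Gaussian on $\mathbb R^n$. Let $\mathcal C_h$ be the space of continuous functions $f:\mathbb R^n\to\mathbb C$ for which there is a constant $c(f)\ge 0$ with $$\Big|\int f(x)\varphi(x)\,dx\Big|\le c(f)\Big\{\iint h(x-y)\varphi(x)\overline{\varphi(y)}\,dx\,dy\Big\}^{1/2}$$ for all $\varphi\in C_c^\infty(\mathbb R^n;\mathbb C)$, and let $\|f\|_h$ be the smallest such constant. For $X\subseteq\mathbb R^n$ and $f\in\mathcal C_h$, the $h$ spline interpolating $f$ on $X$ is the element $s\in\mathcal C_h$ of minimal norm with $s=f$ on $X$, or, when $X=\{x_1,\dots,x_N\}$ is finite, the function $s(x)=\sum_j c_jh(x-x_j)$ with $s(x_i)=f(x_i)$ for all $i$. The fill distance is $d(A,X)=\sup_{y\in A}\inf_{x\in X}|y-x|$ for $A\subseteq\mathbb R^n$. Cubes are closed and may be rotated and translated arbitrarily. Put $\gamma_1=2$, $\gamma_k=2k(1+\gamma_{k-1})$ for $k>1$; $\rho=\sqrt3/e$; $\alpha_n$ the volume of the unit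 ball of $\mathbb R^n$; $$C=\big(3^{3/4}\,e\,\sqrt{2\rho\beta}\,\sqrt n\,e^{2n\gamma_n}\big)^4\,b_0^3\,\gamma_n,\qquad c=\frac{b_0}{8\gamma_n},\qquad \delta_0=\min\{1/C,\ \delta_n\},$$ where $\delta_n=\frac{b_0}{2\gamma_n}$ if $n\in\{1,2\}$, $\delta_n=\frac{b_0}{2\gamma_n(n-1)}$ if $n>1$ is odd, and $\delta_n=\frac{b_0}{2\gamma_n(n-2)}$ if $n>2$ is even; and $$\Delta''=\pi^{\frac{n-1}4}(n\alpha_n)^{\frac12}2^{\frac{n+1}4}\rho^{\frac{n-2}4}\ (n\text{ even}),\qquad \Delta''=\pi^{\frac{n-1}4}(n\alpha_n)^{\frac12}\big(2+\tfrac1e\big)^{\frac12}2^{\frac n4}\rho^{\frac{n-1}4}\ (n\text{ odd}).$$ Let $C'=2C$, $c'=c/2$ and $d_0=\delta_0/2$. Then $C',c',d_0$ are positive and the following holds. Let $\Omega\subseteq\mathbb R^n$ be a union of rotated and translated copies of a cube of side $b_0$, let $X\subseteq\mathbb R^n$, let $f\in\mathcal C_h$, and let $s$ be the $h$ spline interpolating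 $f$ on $X$. Let $E\subseteq\Omega$ be a cube of side $b\ge b_0$ and let $d$ be either of $d(\Omega,X)$ and $d(E,X)$. If $0<d\le d_0$, then for all $x\in E$ $$|f(x)-s(x)|\le \Delta''\,(C'd)^{c'/d}\,\|f\|_h .$$ -/

import Mathlib

open MeasureTheory Set
open scoped ContDiff ComplexConjugate ENNReal

noncomputable section

namespace GaussInterp

/-- The Gaussian `h(x) = exp (-β |x|²)` on `ℝⁿ`, regarded as a complex-valued function. -/
def gaussian (n : ℕ) (β : ℝ) (x : EuclideanSpace ℝ (Fin n)) : ℂ :=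
  ((Real.exp (-β * ‖x‖ ^ 2) : ℝ) : ℂ)

/-! ### The space `C_h` of order zero and its norm -/

/-- The space `𝒟` of complex-valued, compactly supported, smooth functions on `ℝⁿ`. -/
def IsTestFunction {n : ℕ} (φ : EuclideanSpace ℝ (Fin n) → ℂ) : Prop :=
  ContDiff ℝ ∞ φ ∧ HasCompactSupport φ

/-- The quadratic form `∬ h(x - y) φ(x) conj(φ(y)) dx dy`. It is real (and nonnegative) whenever
`h` is positive definite, so that taking the real part loses nothing. -/
def quadForm {n : ℕ} (h φ : EuclideanSpace ℝ (Fin n) → ℂ) : ℝ :=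
  (∫ x, ∫ y, h (x - y) * φ x * conj (φ y)).re

/-- `c` is a nonnegative constant such that
`|∫ f φ| ≤ c (∬ h(x - y) φ(x) conj(φ(y)) dx dy)^(1/2)` for all test functions `φ`. -/
def IsNativeBound {n : ℕ} (h f : EuclideanSpace ℝ (Fin n) → ℂ) (c : ℝ) : Prop :=
  0 ≤ c ∧ ∀ φ : EuclideanSpace ℝ (Fin n) → ℂ, IsTestFunction φ →
    ‖∫ x, f x * φ x‖ ≤ c * Real.sqrt (quadForm h φ)

/-- Membership in the space `C_{h,m}` with `m = 0`. (For `m = 0` the moment conditions on the test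
functions are void.) -/
def MemNative {n : ℕ} (h f : EuclideanSpace ℝ (Fin n) → ℂ) : Prop :=
  Continuous f ∧ ∃ c : ℝ, IsNativeBound h f c

/-- `‖f‖_h`, the smallest constant `c` as in `IsNativeBound`. -/
def nativeNorm {n : ℕ} (h f : EuclideanSpace ℝ (Fin n) → ℂ) : ℝ :=
  sInf {c : ℝ | IsNativeBound h f c}

/-! ### `h` splines -/

/-- `X` is finite and `s` is the interpolant `s(x) = ∑ c_y h(x - y)`, the sum being over `y ∈ X`,
which agrees with `f` on `X`. (In order `0` there is no polynomial part and no side condition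
on the coefficients.) -/
def IsFiniteSpline {n : ℕ} (h : EuclideanSpace ℝ (Fin n) → ℂ) (X : Set (EuclideanSpace ℝ (Fin n)))
    (f s : EuclideanSpace ℝ (Fin n) → ℂ) : Prop :=
  ∃ (T : Finset (EuclideanSpace ℝ (Fin n))) (c : EuclideanSpace ℝ (Fin n) → ℂ),
    (T : Set (EuclideanSpace ℝ (Fin n))) = X ∧
      (∀ x, s x = ∑ y ∈ T, c y * h (x - y)) ∧ EqOn s f X

/-- `s` is an element of minimal norm of `C_h` among those which agree with `f` on `X`. -/
def IsMinNormInterpolant {n : ℕ} (h : EuclideanSpace ℝ (Fin n) → ℂ)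
    (X : Set (EuclideanSpace ℝ (Fin n))) (f s : EuclideanSpace ℝ (Fin n) → ℂ) : Prop :=
  MemNative h s ∧ EqOn s f X ∧
    ∀ g, MemNative h g → EqOn g f X → nativeNorm h s ≤ nativeNorm h g

/-- `s` is the `h` spline that interpolates `f` on `X`: for finite `X` given by the interpolation
formula, and for arbitrary `X` given by the variational problem. -/
def IsSpline {n : ℕ} (h : EuclideanSpace ℝ (Fin n) → ℂ) (X : Set (EuclideanSpace ℝ (Fin n)))
    (f s : EuclideanSpace ℝ (Fin n) → ℂ) : Prop :=
  IsFiniteSpline h X f s ∨ IsMinNormInterpolant h X f s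

/-! ### Cubes and fill distance -/

/-- `E` is a (closed, arbitrarily placed and rotated) cube of side `b` in `ℝⁿ`. Reflections add
nothing to rotations and translations here, as a cube is symmetric. -/
def IsCube {n : ℕ} (b : ℝ) (E : Set (EuclideanSpace ℝ (Fin n))) : Prop :=
  ∃ Φ : EuclideanSpace ℝ (Fin n) ≃ᵃⁱ[ℝ] EuclideanSpace ℝ (Fin n),
    E = Φ '' {x | ∀ i, x i ∈ Icc 0 b}

/-- `Ω` is a union of rotated and translated copies of a cube of side `b`. -/
def IsUnionOfCubes {n : ℕ} (b : ℝ) (Ω : Set (EuclideanSpace ℝ (Fin n))) : Prop :=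
  ∃ 𝓕 : Set (Set (EuclideanSpace ℝ (Fin n))), (∀ Q ∈ 𝓕, IsCube b Q) ∧ Ω = ⋃₀ 𝓕

/-- The fill distance `d(Ω, X) = sup_{y ∈ Ω} inf_{x ∈ X} |y - x|`, possibly infinite. -/
def fillDist {n : ℕ} (Ω X : Set (EuclideanSpace ℝ (Fin n))) : ℝ≥0∞ :=
  ⨆ y ∈ Ω, ⨅ x ∈ X, edist y x

/-! ### The constants -/

/-- `γ₁ = 2` and `γₙ = 2 n (1 + γₙ₋₁)`; the value `γ₀ = 0` is a convention giving `γ₁ = 2`. -/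
def gam : ℕ → ℕ
  | 0 => 0
  | n + 1 => 2 * (n + 1) * (1 + gam n)

/-- The volume `αₙ` of the unit ball of `ℝⁿ`. -/
def unitBallVol (n : ℕ) : ℝ :=
  (volume (Metric.ball (0 : EuclideanSpace ℝ (Fin n)) 1)).toReal

/-- `ρ = √3 / e`. -/
def rho : ℝ := Real.sqrt 3 / Real.exp 1

/-- The constant `Δ''`, which depends only on `n`. -/
def deltaConst (n : ℕ) : ℝ :=
  if Even n then
    Real.pi ^ (((n : ℝ) - 1) / 4) * ((n : ℝ) * unitBallVol n) ^ (1 / 2 : ℝ) *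
      (2 : ℝ) ^ (((n : ℝ) + 1) / 4) * rho ^ (((n : ℝ) - 2) / 4)
  else
    Real.pi ^ (((n : ℝ) - 1) / 4) * ((n : ℝ) * unitBallVol n) ^ (1 / 2 : ℝ) *
      (2 + 1 / Real.exp 1) ^ (1 / 2 : ℝ) * (2 : ℝ) ^ ((n : ℝ) / 4) *
      rho ^ (((n : ℝ) - 1) / 4)

/-- `C = (3^(3/4) e √(2ρβ) √n e^(2nγₙ))⁴ b₀³ γₙ`. -/
def bigC (n : ℕ) (β b₀ : ℝ) : ℝ :=
  ((3 : ℝ) ^ (3 / 4 : ℝ) * Real.exp 1 * Real.sqrt (2 * rho * β) * Real.sqrt n *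
    Real.exp (2 * n * gam n)) ^ 4 * b₀ ^ 3 * gam n

/-- `c = b₀ / (8 γₙ)`. -/
def smallC (n : ℕ) (b₀ : ℝ) : ℝ := b₀ / (8 * gam n)

/-- The threshold `δₙ`. -/
def deltaN (n : ℕ) (b₀ : ℝ) : ℝ :=
  if n = 1 ∨ n = 2 then b₀ / (2 * gam n)
  else if Odd n then b₀ / (2 * gam n * ((n : ℝ) - 1))
  else b₀ / (2 * gam n * ((n : ℝ) - 2))

/-- `δ₀ = min {1 / C, δₙ}`. -/
def delta0 (n : ℕ) (β b₀ : ℝ) : ℝ := min (1 / bigC n β b₀) (deltaN n b₀)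

/-- `C' = 2 C`. -/
def bigC' (n : ℕ) (β b₀ : ℝ) : ℝ := 2 * bigC n β b₀

/-- `c' = c / 2`. -/
def smallC' (n : ℕ) (b₀ : ℝ) : ℝ := smallC n b₀ / 2

/-- `d₀ = δ₀ / 2`. -/
def dist0 (n : ℕ) (β b₀ : ℝ) : ℝ := delta0 n β b₀ / 2

end GaussInterp

end

namespace GaussInterp

/-! ### A quantitative Bernstein inequality at a maximum point -/

/-! A spline error is a linear functional applied to `f - s`. Since `f - s` vanishes on `X`, the
value at `x` does not change when any combination of evaluations at points of `X` is subtracted from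
evaluation at `x`. By `norm_sum_mul_sub_spline_le` the error is then at most twice the native norm
of `f` times the square root of the Gaussian quadratic form of the resulting functional.

The combination is chosen so that the functional kills polynomials of degree below `k`
(`exists_reproduction`). Expand `exp (-β|a - b|²)` in powers of `|a - b|²`. Every monomial of the
`j`-th power has degree at most `j` in `a` or in `b`, so all terms with `j < k` disappear
(`sum_sum_gaussian_le`). What remains is the squared total variation of the functional times `(β
r²)^k / k!`, where `r` bounds the distances between its points.

The weights must grow only exponentially in `k`. By Hahn–Banach this follows from a norming
inequality: a polynomial small on a set of mesh a fixed multiple of `R / k` is small, up to an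
exponential factor, on and near a ball of radius `R`. In dimension one this is Lagrange
interpolation. In higher dimension (`linePoly_norming_unitBall`) one maximizes `|p(z)| (1 - |z|²)^m`
over the unit ball. The maximum lies well inside, and a Bernstein-type estimate along the chord to a
nearby data point shows that the polynomial is still large there. Only restrictions to lines enter,
hence the space `linePoly`.

Finally `k` is taken comparable to `b₀ / d`. The factorial then beats the exponential weights, which
gives `(C' d)^(c' / d)` (`four_mul_pow_div_sqrt_factorial_le`). -/

/-- The span of the Chebyshev polynomials reduces this to `cos i(θ + s) + cos i(θ - s) = 2 cos iθ
cos is`. The symmetrization moves an interior maximum point to the endpoint `1`, where Markov's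
inequality is sharp. -/
theorem exists_cosine_symmetrization {D : ℕ} {P : Polynomial ℝ} (hP : P.degree ≤ D) (θ : ℝ) :
    ∃ G : Polynomial ℝ, G.degree ≤ D ∧ ∀ s : ℝ, 2 * G.eval (Real.cos s) =
      P.eval (Real.cos (θ + s)) + P.eval (Real.cos (θ - s)) := by
  have hmem : P ∈ Polynomial.degreeLT ℝ (D + 1) := by
    rw [Polynomial.mem_degreeLT]
    exact lt_of_le_of_lt hP (by exact_mod_cast Nat.lt_succ_self D)
  rw [← Polynomial.Sequence.span_degreeLT (Polynomial.Chebyshev.chebyshevTsequence ℝ)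
    (by simp)] at hmem
  clear hP
  induction hmem using Submodule.span_induction with
  | mem Q hQ =>
    obtain ⟨i, hi, rfl⟩ := hQ
    refine ⟨Real.cos (i * θ) • Polynomial.Chebyshev.T ℝ i, ?_, fun s => ?_⟩
    · refine (Polynomial.degree_smul_le _ _).trans ?_
      rw [Polynomial.Chebyshev.degree_T]
      simp only [mem_Iio] at hi
      simpa using Nat.lt_succ_iff.mp hi
    · change _ = (Polynomial.Chebyshev.T ℝ i).eval _ + (Polynomial.Chebyshev.T ℝ i).eval _
      simp only [Polynomial.eval_smul, smul_eq_mul, Polynomial.Chebyshev.T_real_cos]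
      push_cast
      rw [mul_add, mul_sub, Real.cos_add, Real.cos_sub]
      ring
  | zero => exact ⟨0, by simp, by simp⟩
  | add p q _ _ hp hq =>
    obtain ⟨G, hG, hG'⟩ := hp
    obtain ⟨H, hH, hH'⟩ := hq
    refine ⟨G + H, (Polynomial.degree_add_le _ _).trans (max_le hG hH), fun s => ?_⟩
    have h1 := hG' s
    have h2 := hH' s
    simp only [Polynomial.eval_add]
    linarith
  | smul a p _ hp =>
    obtain ⟨G, hG, hG'⟩ := hp
    refine ⟨a • G, (Polynomial.degree_smul_le _ _).trans hG, fun s => ?_⟩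
    have h1 := hG' s
    simp only [Polynomial.eval_smul, smul_eq_mul]
    linear_combination a * h1

/-- Markov's inequality at an endpoint, `|G'(1)| ≤ T_D'(1) = D²`, transported to `[-1, v]` by the
affine map `A` that sends `1` to `v`. -/
theorem derivative_eval_le_of_abs_le_one {D : ℕ} {G : Polynomial ℝ} (hG : G.degree ≤ D)
    (hb : ∀ t ∈ Icc (-1 : ℝ) 1, |G.eval t| ≤ 1) {v : ℝ} (hv : -1 < v) (hv1 : v ≤ 1) :
    G.derivative.eval v ≤ 2 * (D : ℝ) ^ 2 / (1 + v) := by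
  set A : Polynomial ℝ := Polynomial.C ((v + 1) / 2) * Polynomial.X + Polynomial.C ((v - 1) / 2)
    with hA
  have hAd : A.natDegree ≤ 1 := Polynomial.natDegree_linear_le
  have hd : (G.comp A).degree ≤ D := by
    refine Polynomial.degree_le_of_natDegree_le ((Polynomial.natDegree_comp_le).trans ?_)
    have := Polynomial.natDegree_le_of_degree_le hG
    nlinarith
  have h := Polynomial.Chebyshev.eval_iterate_derivative_le_of_forall_abs_le_one (k := 1)
    (le_refl (1 : ℝ)) hd (fun t ht => by
      rw [Polynomial.eval_comp]
      apply hb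
      simp only [hA, Polynomial.eval_add, Polynomial.eval_mul, Polynomial.eval_C,
        Polynomial.eval_X]
      constructor <;> nlinarith [ht.1, ht.2])
  simp only [Function.iterate_one, Polynomial.derivative_comp, Polynomial.eval_mul,
    Polynomial.eval_comp, Polynomial.Chebyshev.derivative_T_eval_one] at h
  have e1 : A.eval 1 = v := by simp [hA]; ring
  have e2 : A.derivative.eval 1 = (v + 1) / 2 := by simp [hA]
  rw [e1, e2] at h
  rw [le_div_iff₀ (by linarith)]
  push_cast at h
  linarith

theorem one_sub_le_eval_of_eval_one_eq_one {D : ℕ} {G : Polynomial ℝ} (hG : G.degree ≤ D)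
    (hb : ∀ t ∈ Icc (-1 : ℝ) 1, |G.eval t| ≤ 1) (h1 : G.eval 1 = 1) {v : ℝ} (hv : -1 < v)
    (hv1 : v ≤ 1) : 1 - 2 * (D : ℝ) ^ 2 * ((1 - v) / (1 + v)) ≤ G.eval v := by
  have hv0 : 0 < 1 + v := by linarith
  have h := Convex.image_sub_le_mul_sub_of_deriv_le (convex_Icc v 1) (f := fun t => G.eval t)
    G.continuous.continuousOn G.differentiable.differentiableOn
    (C := 2 * (D : ℝ) ^ 2 / (1 + v)) (fun ξ hξ => by
      rw [interior_Icc] at hξ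
      rw [Polynomial.deriv]
      refine (derivative_eval_le_of_abs_le_one hG hb (by linarith [hξ.1]) hξ.2.le).trans ?_
      have := hξ.1
      gcongr) v (left_mem_Icc.mpr hv1) 1 (right_mem_Icc.mpr hv1) hv1
  rw [h1] at h
  have : 2 * (D : ℝ) ^ 2 / (1 + v) * (1 - v) = 2 * (D : ℝ) ^ 2 * ((1 - v) / (1 + v)) := by ring
  linarith

/-- If a polynomial of degree at most `D` attains its maximum modulus over `[-1, 1]` at `t₀`, then
it stays large at distance `O(1 / D)` of `t₀`, in the Chebyshev metric. -/
theorem eval_ge_near_max {D : ℕ} {P : Polynomial ℝ} (hP : P.degree ≤ D)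
    (hb : ∀ t ∈ Icc (-1 : ℝ) 1, |P.eval t| ≤ 1) {t₀ t : ℝ} (ht₀ : t₀ ∈ Icc (-1 : ℝ) 1)
    (ht : t ∈ Icc (-1 : ℝ) 1) (h1 : P.eval t₀ = 1) (hpos : 0 < (1 - t ^ 2) + (1 - t₀ ^ 2)) :
    1 - 4 * (D : ℝ) ^ 2 * ((t - t₀) ^ 2 / ((1 - t ^ 2) + (1 - t₀ ^ 2))) ≤ P.eval t := by
  obtain ⟨θ₀, hθ₀, rfl⟩ : ∃ θ ∈ Icc 0 Real.pi, Real.cos θ = t₀ :=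
    ⟨Real.arccos t₀, ⟨Real.arccos_nonneg _, Real.arccos_le_pi _⟩, Real.cos_arccos ht₀.1 ht₀.2⟩
  obtain ⟨θ, hθ, rfl⟩ : ∃ θ ∈ Icc 0 Real.pi, Real.cos θ = t :=
    ⟨Real.arccos t, ⟨Real.arccos_nonneg _, Real.arccos_le_pi _⟩, Real.cos_arccos ht.1 ht.2⟩
  obtain ⟨G, hG, hGe⟩ := exists_cosine_symmetrization hP θ₀
  have hcos : ∀ x, Real.cos x ∈ Icc (-1 : ℝ) 1 := fun x => ⟨Real.neg_one_le_cos x, Real.cos_le_one x⟩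
  have hGb : ∀ t ∈ Icc (-1 : ℝ) 1, |G.eval t| ≤ 1 := fun t ht => by
    have h := hGe (Real.arccos t)
    rw [Real.cos_arccos ht.1 ht.2] at h
    have a1 := abs_le.mp (hb _ (hcos (θ₀ + Real.arccos t)))
    have a2 := abs_le.mp (hb _ (hcos (θ₀ - Real.arccos t)))
    rw [abs_le]
    constructor <;> linarith [a1.1, a1.2, a2.1, a2.2]
  have hG1 : G.eval 1 = 1 := by
    have h := hGe 0
    simp only [Real.cos_zero, add_zero, sub_zero, h1] at h
    linarith
  have hS0 := Real.sin_nonneg_of_nonneg_of_le_pi hθ₀.1 hθ₀.2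
  have hS := Real.sin_nonneg_of_nonneg_of_le_pi hθ.1 hθ.2
  have q0 := Real.sin_sq_add_cos_sq θ₀
  have q := Real.sin_sq_add_cos_sq θ
  have e0 : 1 - Real.cos θ₀ ^ 2 = Real.sin θ₀ ^ 2 := by linarith
  have e : 1 - Real.cos θ ^ 2 = Real.sin θ ^ 2 := by linarith
  rw [e0, e] at hpos ⊢
  set C₀ := Real.cos θ₀
  set C := Real.cos θ
  set S₀ := Real.sin θ₀
  set S := Real.sin θ
  have hv : Real.cos (θ - θ₀) = C * C₀ + S * S₀ := Real.cos_sub θ θ₀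
  -- Half-angle identity: both sides express `tan² ((θ - θ₀) / 2) = ((C - C₀) / (S + S₀))²`, cleared
  -- of denominators.
  have key : (1 - Real.cos (θ - θ₀)) * (S + S₀) ^ 2 = (1 + Real.cos (θ - θ₀)) * (C - C₀) ^ 2 := by
    rw [hv]
    have hS2 : S ^ 2 = 1 - C ^ 2 := by linarith
    have hS02 : S₀ ^ 2 = 1 - C₀ ^ 2 := by linarith
    linear_combination (1 - C * C₀ - S * S₀ - 2 * S₀ ^ 2) * hS2 + (1 - C * C₀ - S * S₀ - 2 * (1 - C ^ 2)) * hS02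
  have hSS : 0 < (S + S₀) ^ 2 := by nlinarith [mul_nonneg hS hS0]
  have hvgt : -1 < Real.cos (θ - θ₀) := by
    refine lt_of_le_of_ne (hcos _).1 fun h => ?_
    rw [← h] at key
    nlinarith
  have hv0 : 0 < 1 + Real.cos (θ - θ₀) := by linarith
  have hw : (1 - Real.cos (θ - θ₀)) / (1 + Real.cos (θ - θ₀)) = (C - C₀) ^ 2 / (S + S₀) ^ 2 := by
    rw [div_eq_div_iff hv0.ne' hSS.ne', key]
    ring
  have hGv := one_sub_le_eval_of_eval_one_eq_one hG hGb hG1 hvgt (hcos _).2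
  rw [hw] at hGv
  -- The mirror value at angle `2θ₀ - θ` is at most `1`, so `P(cos θ) ≥ 2G - 1`; this doubles the
  -- loss from `2D²` to `4D²`.
  have h2 := hGe (θ - θ₀)
  rw [add_sub_cancel] at h2
  have h3 := (abs_le.mp (hb _ (hcos (θ₀ - (θ - θ₀))))).2
  have h4 : (C - C₀) ^ 2 / (S + S₀) ^ 2 ≤ (C - C₀) ^ 2 / (S ^ 2 + S₀ ^ 2) := by
    gcongr
    nlinarith [mul_nonneg hS hS0]
  have h5 : 4 * (D : ℝ) ^ 2 * ((C - C₀) ^ 2 / (S + S₀) ^ 2) ≤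
      4 * (D : ℝ) ^ 2 * ((C - C₀) ^ 2 / (S ^ 2 + S₀ ^ 2)) := by gcongr
  linarith

/-! ### Growth of polynomials outside `[-1, 1]` -/

theorem eval_T_le_two_mul_pow {x : ℝ} (hx : 1 ≤ x) (m : ℕ) :
    (Polynomial.Chebyshev.T ℝ m).eval x ≤ (2 * x) ^ m := by
  induction m using Nat.strong_induction_on with
  | _ m ih =>
    match m with
    | 0 => simp
    | 1 => simp; linarith
    | m + 2 =>
      have h := ih (m + 1) (by omega)
      have h0 := Polynomial.Chebyshev.one_le_eval_T_real m hx
      push_cast at h ⊢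
      rw [Polynomial.Chebyshev.T_add_two]
      simp only [Polynomial.eval_sub, Polynomial.eval_mul, Polynomial.eval_ofNat,
        Polynomial.eval_X]
      calc 2 * x * _ - _ ≤ 2 * x * (2 * x) ^ (m + 1) - 1 := by gcongr
        _ ≤ (2 * x) ^ (m + 2) := by rw [pow_succ' _ (m + 1)]; linarith

theorem eval_le_mul_two_mul_pow {m : ℕ} {P : Polynomial ℝ} (hP : P.degree ≤ m) {B : ℝ}
    (hB : 0 ≤ B) (hb : ∀ t ∈ Icc (-1 : ℝ) 1, |P.eval t| ≤ B) {x : ℝ} (hx : 1 ≤ x) :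
    P.eval x ≤ B * (2 * x) ^ m := by
  -- The bound `B` may be zero, so the normalization divides by a slightly larger positive number.
  refine le_of_forall_pos_le_add fun ε hε => ?_
  have hT : ∀ B' : ℝ, 0 < B' → B ≤ B' → P.eval x ≤ B' * (2 * x) ^ m := fun B' hB' hle => by
    have h := Polynomial.Chebyshev.eval_iterate_derivative_le_of_forall_abs_le_one (k := 0)
      (P := B'⁻¹ • P) hx ((Polynomial.degree_smul_le _ _).trans hP) (fun t ht => by
        rw [Polynomial.eval_smul, smul_eq_mul, abs_mul, abs_of_pos (inv_pos.mpr hB'),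
          inv_mul_le_iff₀ hB', mul_one]
        exact (hb t ht).trans hle)
    simp only [Function.iterate_zero, id_eq, Polynomial.eval_smul, smul_eq_mul] at h
    rw [inv_mul_le_iff₀ hB'] at h
    exact h.trans (mul_le_mul_of_nonneg_left (eval_T_le_two_mul_pow hx m) hB'.le)
  have hpow : 0 < (2 * x) ^ m := by positivity
  have h := hT (B + ε / (2 * x) ^ m) (by positivity) (by simpa using (by positivity))
  rwa [add_mul, div_mul_cancel₀ _ hpow.ne'] at h

/-! ### Norming sets for polynomials -/

/-- Continuous real functions whose restriction to every line is a polynomial of degree less than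
`k` in the affine parameter. -/
def linePoly (V : Type*) [NormedAddCommGroup V] [NormedSpace ℝ V] (k : ℕ) :
    Submodule ℝ (V → ℝ) where
  carrier := {p | Continuous p ∧ ∀ a u : V, ∃ P : Polynomial ℝ, P.degree < k ∧
    ∀ t : ℝ, p (a + t • u) = P.eval t}
  add_mem' := by
    rintro p q ⟨hp, hp'⟩ ⟨hq, hq'⟩
    refine ⟨hp.add hq, fun a u => ?_⟩
    obtain ⟨P, hP, hPe⟩ := hp' a u
    obtain ⟨Q, hQ, hQe⟩ := hq' a u
    exact ⟨P + Q, lt_of_le_of_lt (Polynomial.degree_add_le _ _) (max_lt hP hQ), fun t => by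
      simp [hPe, hQe]⟩
  zero_mem' := ⟨continuous_const, fun a u => ⟨0, by simp, by simp⟩⟩
  smul_mem' := by
    rintro r p ⟨hp, hp'⟩
    refine ⟨hp.const_smul r, fun a u => ?_⟩
    obtain ⟨P, hP, hPe⟩ := hp' a u
    exact ⟨r • P, lt_of_le_of_lt (Polynomial.degree_smul_le _ _) hP, fun t => by simp [hPe]⟩

theorem degree_le_of_degree_lt_succ {m : ℕ} {P : Polynomial ℝ}
    (hP : P.degree < ((m + 1 : ℕ) : WithBot ℕ)) : P.degree ≤ m := by
  rw [Polynomial.degree_lt_iff_coeff_zero] at hP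
  exact (Polynomial.degree_le_iff_coeff_zero _ _).mpr fun i hi => hP i (by exact_mod_cast hi)

section Ball

variable {V : Type*} [NormedAddCommGroup V] [InnerProductSpace ℝ V]

theorem linePoly_comp_affine {k : ℕ} {p : V → ℝ} (hp : p ∈ linePoly V k) (c : V) (r : ℝ) :
    (fun v => p (c + r • v)) ∈ linePoly V k := by
  refine ⟨hp.1.comp (by fun_prop), fun a u => ?_⟩
  obtain ⟨P, hP, hPe⟩ := hp.2 (c + r • a) (r • u)
  refine ⟨P, hP, fun t => ?_⟩
  simp only [← hPe, smul_add, smul_comm r t u, add_assoc]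

theorem linePoly_one_const {p : V → ℝ} (hp : p ∈ linePoly V 1) (x y : V) : p x = p y := by
  obtain ⟨P, hP, hPe⟩ := hp.2 x (y - x)
  rw [Polynomial.eq_C_of_degree_le_zero (p := P)
    (by simpa using degree_le_of_degree_lt_succ (m := 0) hP)] at hPe
  have h0 := hPe 0
  have h1 := hPe 1
  simp only [zero_smul, add_zero, one_smul, add_sub_cancel, Polynomial.eval_C] at h0 h1
  rw [h0, h1]

/-- Restrict to the line through `0` and `z`, parametrized so that `[-1, 1]` stays in the ball of
radius `a` and `z` sits at parameter `u`; then the one-variable growth bound applies to the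
restriction and its negative. -/
theorem linePoly_growth {m : ℕ} {p : V → ℝ} (hp : p ∈ linePoly V (m + 1)) {a B : ℝ} (hB : 0 ≤ B)
    (hb : ∀ z, ‖z‖ ≤ a → |p z| ≤ B) {u : ℝ} (hu : 1 ≤ u) {z : V} (hz : ‖z‖ ≤ u * a) :
    |p z| ≤ B * (2 * u) ^ m := by
  have hu0 : 0 < u := by linarith
  obtain ⟨P, hP, hPe⟩ := hp.2 0 (u⁻¹ • z)
  have hP' : P.degree ≤ m := degree_le_of_degree_lt_succ hP
  have hbd : ∀ t ∈ Icc (-1 : ℝ) 1, |P.eval t| ≤ B := fun t ht => by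
    rw [← hPe]
    apply hb
    rw [zero_add, norm_smul, norm_smul, Real.norm_eq_abs, Real.norm_eq_abs, abs_of_pos
      (inv_pos.mpr hu0)]
    have h1 : |t| ≤ 1 := abs_le.mpr ht
    have h2 : u⁻¹ * ‖z‖ ≤ a := by rw [inv_mul_le_iff₀ hu0]; exact hz
    have h3 : 0 ≤ u⁻¹ * ‖z‖ := by positivity
    nlinarith
  have hzu : p z = P.eval u := by
    rw [← hPe, zero_add, smul_smul, mul_inv_cancel₀ hu0.ne', one_smul]
  rw [hzu, abs_le']
  refine ⟨eval_le_mul_two_mul_pow hP' hB hbd hu, ?_⟩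
  have := eval_le_mul_two_mul_pow (P := -P) (by rwa [Polynomial.degree_neg]) hB
    (fun t ht => by rw [Polynomial.eval_neg, abs_neg]; exact hbd t ht) hu
  rwa [Polynomial.eval_neg] at this

/-- Near a maximum point of the weighted polynomial `|p(z)| (1 - |z|²)ᵐ` over the unit ball, the
weighted polynomial does not vanish. -/
theorem weighted_eval_ge_near_max {m : ℕ} {p : V → ℝ} (hp : p ∈ linePoly V (m + 1)) {w y : V}
    (hw : ‖w‖ < 1) (hy : ‖y‖ ≤ 1)
    (hmax : ∀ z, ‖z‖ ≤ 1 → |p z * (1 - ‖z‖ ^ 2) ^ m| ≤ |p w * (1 - ‖w‖ ^ 2) ^ m|) :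
    |p w * (1 - ‖w‖ ^ 2) ^ m| * (1 - 4 * ((3 * m : ℕ) : ℝ) ^ 2 *
      (‖y - w‖ ^ 2 / ((1 - ‖y‖ ^ 2) + (1 - ‖w‖ ^ 2)))) ≤ |p y * (1 - ‖y‖ ^ 2) ^ m| := by
  set M := p w * (1 - ‖w‖ ^ 2) ^ m with hM
  rcases eq_or_ne M 0 with h0 | h0
  · rw [h0, abs_zero, zero_mul]; exact abs_nonneg _
  rcases eq_or_ne y w with rfl | hyw
  · simp [hM]
  set δ := ‖y - w‖ with hδ
  have hδ0 : 0 < δ := norm_pos_iff.mpr (sub_ne_zero.mpr hyw)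
  set u : V := δ⁻¹ • (y - w) with hu
  have hu1 : ‖u‖ = 1 := by
    rw [hu, norm_smul, Real.norm_eq_abs, abs_of_pos (inv_pos.mpr hδ0), ← hδ,
      inv_mul_cancel₀ hδ0.ne']
  set σ : ℝ := inner ℝ w u with hσ
  -- The foot of the perpendicular from the origin to the line through `w` and `y`. Measured from
  -- it, the squared norm has no linear term, and the chord has half-length `ℓ = √(1 - ‖f‖²)`.
  set f : V := w - σ • u with hf
  have hfu : inner ℝ f u = 0 := by
    rw [hf, inner_sub_left, real_inner_smul_left, real_inner_self_eq_norm_sq, hu1]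
    simp [hσ]
  have hn : ∀ t : ℝ, ‖f + t • u‖ ^ 2 = ‖f‖ ^ 2 + t ^ 2 := fun t => by
    rw [norm_add_sq_real, real_inner_smul_right, hfu, norm_smul, hu1, Real.norm_eq_abs]
    simp
  have hw' : w = f + σ • u := by rw [hf]; simp
  have hy' : y = f + (σ + δ) • u := by
    have : δ • u = y - w := by rw [hu, smul_smul, mul_inv_cancel₀ hδ0.ne', one_smul]
    rw [add_smul, this, ← add_assoc, ← hw']; simp
  have hnw : ‖w‖ ^ 2 = ‖f‖ ^ 2 + σ ^ 2 := by conv_lhs => rw [hw', hn]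
  have hny : ‖y‖ ^ 2 = ‖f‖ ^ 2 + (σ + δ) ^ 2 := by conv_lhs => rw [hy', hn]
  have hw1 : ‖w‖ ^ 2 < 1 := by nlinarith [norm_nonneg w]
  have hy1 : ‖y‖ ^ 2 ≤ 1 := by nlinarith [norm_nonneg y]
  set ℓ := Real.sqrt (1 - ‖f‖ ^ 2) with hℓ
  have hℓ2 : ℓ ^ 2 = 1 - ‖f‖ ^ 2 := Real.sq_sqrt (by nlinarith [sq_nonneg σ])
  have hℓ0 : 0 < ℓ := Real.sqrt_pos.mpr (by nlinarith [sq_nonneg σ])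
  obtain ⟨P, hP, hPe⟩ := hp.2 f (ℓ • u)
  -- On the chord rescaled to `[-1, 1]` the weight is `(ℓ² (1 - t²))^m`, so the normalized weighted
  -- polynomial has degree at most `m + 2m`.
  set Q : Polynomial ℝ := M⁻¹ • (P * (Polynomial.C (ℓ ^ 2) * (1 - Polynomial.X ^ 2)) ^ m) with hQ
  have hQe : ∀ t : ℝ, Q.eval t = M⁻¹ * (p (f + (t * ℓ) • u) * (1 - ‖f + (t * ℓ) • u‖ ^ 2) ^ m) := by
    intro t
    rw [hn, mul_smul, hPe]
    simp only [hQ, Polynomial.eval_smul, smul_eq_mul, Polynomial.eval_mul, Polynomial.eval_pow,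
      Polynomial.eval_C, Polynomial.eval_sub, Polynomial.eval_one, Polynomial.eval_X]
    have : 1 - (‖f‖ ^ 2 + (t * ℓ) ^ 2) = ℓ ^ 2 * (1 - t ^ 2) := by rw [mul_pow, hℓ2]; ring
    rw [this]
  have hQd : Q.degree ≤ (3 * m : ℕ) := by
    refine (Polynomial.degree_smul_le _ _).trans (Polynomial.degree_le_of_natDegree_le ?_)
    refine Polynomial.natDegree_mul_le.trans ?_
    have h1 : P.natDegree ≤ m :=
      Polynomial.natDegree_le_of_degree_le (degree_le_of_degree_lt_succ hP)
    have h2 : (Polynomial.C (ℓ ^ 2) * (1 - Polynomial.X ^ 2)).natDegree ≤ 2 := by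
      refine (Polynomial.natDegree_C_mul_le _ _).trans ?_
      refine (Polynomial.natDegree_sub_le _ _).trans ?_
      simp
    have h3 := (Polynomial.natDegree_pow_le
      (p := Polynomial.C (ℓ ^ 2) * (1 - Polynomial.X ^ 2)) (n := m)).trans
      (Nat.mul_le_mul_left m h2)
    omega
  have hball : ∀ t ∈ Icc (-1 : ℝ) 1, ‖f + (t * ℓ) • u‖ ≤ 1 := fun t ht => by
    have h1 : t ^ 2 ≤ 1 := by nlinarith [ht.1, ht.2]
    have h2 := hn (t * ℓ)
    rw [mul_pow, hℓ2] at h2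
    have h3 : 0 ≤ 1 - ‖f‖ ^ 2 := by rw [← hℓ2]; positivity
    exact (sq_le_one_iff₀ (norm_nonneg _)).mp (by nlinarith)
  have hQb : ∀ t ∈ Icc (-1 : ℝ) 1, |Q.eval t| ≤ 1 := fun t ht => by
    rw [hQe, abs_mul, abs_inv, inv_mul_le_iff₀ (abs_pos.mpr h0), mul_one]
    exact hmax _ (hball t ht)
  have hmem : ∀ s : ℝ, ‖f‖ ^ 2 + s ^ 2 ≤ 1 → s / ℓ ∈ Icc (-1 : ℝ) 1 := fun s hs => by
    have : |s| ≤ ℓ := abs_le_of_sq_le_sq (by rw [hℓ2]; linarith) hℓ0.le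
    rw [abs_le] at this
    constructor
    · rw [le_div_iff₀ hℓ0]; linarith
    · rw [div_le_iff₀ hℓ0]; linarith
  have hsq : ∀ s : ℝ, 1 - (s / ℓ) ^ 2 = (1 - (‖f‖ ^ 2 + s ^ 2)) / ℓ ^ 2 := fun s => by
    rw [div_pow, eq_div_iff (by positivity), sub_mul, div_mul_cancel₀ _ (by positivity), hℓ2]
    ring
  have hdiv : ∀ s : ℝ, s / ℓ * ℓ = s := fun s => div_mul_cancel₀ _ hℓ0.ne'
  have hmain := eval_ge_near_max hQd hQb (hmem σ (by linarith)) (hmem (σ + δ) (by linarith))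
    (by rw [hQe, hdiv, ← hw', ← hM, inv_mul_cancel₀ h0]) (by
      rw [hsq, hsq, ← hnw, ← hny, ← add_div]
      exact div_pos (by linarith) (by positivity))
  rw [hQe, hdiv, ← hy', hsq, hsq, ← hnw, ← hny, ← add_div, ← sub_div, add_sub_cancel_left,
    div_pow, div_div_div_cancel_right₀ (by positivity)] at hmain
  calc |M| * _ ≤ |M| * (M⁻¹ * (p y * (1 - ‖y‖ ^ 2) ^ m)) := by gcongr
    _ ≤ |M| * |M⁻¹ * (p y * (1 - ‖y‖ ^ 2) ^ m)| := by gcongr; exact le_abs_self _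
    _ = |p y * (1 - ‖y‖ ^ 2) ^ m| := by
      rw [abs_mul M⁻¹, abs_inv, mul_inv_cancel_left₀ (abs_ne_zero.mpr h0)]

/-- The estimate of `weighted_eval_ge_near_max` degenerates at the sphere. The weight repairs this:
growth from an inner ball forces the weighted maximum point `w` away from the sphere, and a data
point near `w` then retains a fifth of the maximum `M`. The same growth bound carries the estimate
out to radius `κ`. -/
theorem linePoly_norming_unitBall [ProperSpace V] {m : ℕ} {p : V → ℝ}
    (hp : p ∈ linePoly V (m + 1)) {S : Set V} {d : ℝ} (hd : d * (12 * (m + 1)) ≤ 1)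
    (hS : ∀ z : V, ‖z‖ ≤ 1 → ∃ y ∈ S, ‖y - z‖ ≤ d) {μ : ℝ}
    (hμ : ∀ y ∈ S, ‖y‖ ≤ 1 → |p y| ≤ μ) {κ : ℝ} (hκ : 1 ≤ κ) {x : V} (hx : ‖x‖ ≤ κ) :
    |p x| ≤ 5 * (3 * Real.sqrt 3 * κ) ^ m * μ := by
  obtain ⟨y₀, hy₀S, hy₀⟩ := hS 0 (by simp)
  rw [sub_zero] at hy₀
  have hd0 : 0 ≤ d := (norm_nonneg _).trans hy₀
  have hm0 : (0 : ℝ) ≤ m := Nat.cast_nonneg m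
  have hd1 : d ≤ 1 / 12 := by nlinarith
  have hμ0 : 0 ≤ μ := (abs_nonneg _).trans (hμ y₀ hy₀S (by linarith))
  rcases Nat.eq_zero_or_pos m with rfl | hm
  · rw [linePoly_one_const hp x y₀]
    have := hμ y₀ hy₀S (by linarith)
    simp only [pow_zero]
    linarith
  have hm1 : (1 : ℝ) ≤ m := by exact_mod_cast hm
  have hd2 : d ≤ 1 / 24 := by nlinarith
  obtain ⟨w, hwB, hwmax⟩ := (isCompact_closedBall (0 : V) 1).exists_isMaxOn
    (Metric.nonempty_closedBall.mpr zero_le_one)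
    (f := fun z => |p z * (1 - ‖z‖ ^ 2) ^ m|)
    (by have := hp.1; exact Continuous.continuousOn (by fun_prop))
  rw [mem_closedBall_zero_iff] at hwB
  have hmax : ∀ z, ‖z‖ ≤ 1 → |p z * (1 - ‖z‖ ^ 2) ^ m| ≤ |p w * (1 - ‖w‖ ^ 2) ^ m| :=
    fun z hz => hwmax (mem_closedBall_zero_iff.mpr hz)
  set M := |p w * (1 - ‖w‖ ^ 2) ^ m| with hM
  have hM0 : 0 ≤ M := abs_nonneg _
  -- This radius maximizes `a (1 - a²)`, hence minimizes the growth constant `2 / (a (1 - a²)) =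
  -- 3√3`.
  set a := (Real.sqrt 3)⁻¹ with ha
  have hs3 : Real.sqrt 3 ^ 2 = 3 := Real.sq_sqrt (by norm_num)
  have hs30 : 0 < Real.sqrt 3 := by positivity
  have ha2 : a ^ 2 = 1 / 3 := by rw [ha, inv_pow, hs3]; norm_num
  have ha0 : 0 < a := by positivity
  have hinner : ∀ z : V, ‖z‖ ≤ a → |p z| ≤ (3 / 2) ^ m * M := fun z hz => by
    have h1 : ‖z‖ ^ 2 ≤ 1 / 3 := by rw [← ha2]; gcongr
    have h2 := hmax z ((sq_le_one_iff₀ (norm_nonneg z)).mp (by linarith))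
    rw [abs_mul, abs_of_nonneg (a := (1 - ‖z‖ ^ 2) ^ m) (pow_nonneg (by linarith) _)] at h2
    have h3 : (2 / 3 : ℝ) ^ m ≤ (1 - ‖z‖ ^ 2) ^ m := by gcongr; linarith
    have h4 : |p z| * (2 / 3 : ℝ) ^ m ≤ M :=
      (mul_le_mul_of_nonneg_left h3 (abs_nonneg _)).trans h2
    calc |p z| = (3 / 2) ^ m * (|p z| * (2 / 3) ^ m) := by
          rw [mul_left_comm, ← mul_pow]; norm_num
      _ ≤ _ := by gcongr
  have hgrow : ∀ (s : ℝ) (z : V), 1 ≤ Real.sqrt 3 * s → ‖z‖ ≤ s →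
      |p z| ≤ (3 * Real.sqrt 3 * s) ^ m * M := fun s z hs hz => by
    have h := linePoly_growth hp (by positivity) hinner hs (z := z) (by
      rw [ha, mul_comm (Real.sqrt 3), mul_assoc, mul_inv_cancel₀ hs30.ne', mul_one]; exact hz)
    calc |p z| ≤ _ := h
      _ = ((3 / 2) * (2 * (Real.sqrt 3 * s))) ^ m * M := by rw [mul_pow (3 / 2 : ℝ)]; ring
      _ = _ := by ring
  have hMμ : M ≤ 5 * μ := by
    rcases hM0.eq_or_lt with h0 | h0
    · rw [← h0]; positivity
    have hw1 : ‖w‖ ^ 2 ≤ 1 := (sq_le_one_iff₀ (norm_nonneg w)).mpr hwB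
    -- Otherwise `27 r² (1 - r²)² < 1` at `r = ‖w‖`, and the growth bound would give `M < M`.
    have hr : ‖w‖ ^ 2 ≤ 4 / 5 := by
      by_contra! hcon
      have h1 : 1 ≤ Real.sqrt 3 * ‖w‖ := by
        have : (1 : ℝ) ^ 2 ≤ (Real.sqrt 3 * ‖w‖) ^ 2 := by rw [mul_pow, hs3]; linarith
        exact (sq_le_sq₀ zero_le_one (by positivity)).mp this
      have h2 := hgrow ‖w‖ w h1 le_rfl
      have h3 : M ≤ (3 * Real.sqrt 3 * ‖w‖ * (1 - ‖w‖ ^ 2)) ^ m * M := by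
        conv_lhs => rw [hM]
        rw [abs_mul, abs_of_nonneg (a := (1 - ‖w‖ ^ 2) ^ m) (pow_nonneg (by linarith) _), mul_pow,
          mul_right_comm]
        have : 0 ≤ (1 - ‖w‖ ^ 2) ^ m := pow_nonneg (by linarith) _
        gcongr
      have hnn : 0 ≤ 3 * Real.sqrt 3 * ‖w‖ * (1 - ‖w‖ ^ 2) :=
        mul_nonneg (by positivity) (by linarith)
      have h4 : (3 * Real.sqrt 3 * ‖w‖ * (1 - ‖w‖ ^ 2)) < 1 := by
        refine (sq_lt_one_iff₀ hnn).mp ?_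
        have : (3 * Real.sqrt 3 * ‖w‖ * (1 - ‖w‖ ^ 2)) ^ 2 =
            27 * ‖w‖ ^ 2 * (1 - ‖w‖ ^ 2) ^ 2 := by
          rw [mul_pow, mul_pow, mul_pow, hs3]; ring
        rw [this]
        have h5 : (1 - ‖w‖ ^ 2) ^ 2 ≤ (1 / 5) ^ 2 :=
          pow_le_pow_left₀ (by linarith) (by linarith) 2
        nlinarith [sq_nonneg (1 - ‖w‖ ^ 2)]
      have h5 := pow_lt_one₀ hnn h4 hm.ne'
      nlinarith
    have hwlt : ‖w‖ < 1 := (sq_lt_one_iff₀ (norm_nonneg w)).mp (by linarith)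
    have hw9 : ‖w‖ ≤ 9 / 10 := abs_le_of_sq_le_sq' (by linarith) (by norm_num) |>.2
    obtain ⟨y, hyS, hy⟩ := hS w hwB
    have hyn : ‖y‖ ≤ ‖w‖ + 1 / 24 := by
      have := norm_le_insert' y w
      linarith
    have hy1 : ‖y‖ ≤ 1 := by linarith
    have hy2 : ‖y‖ ^ 2 ≤ 878 / 1000 := by nlinarith [norm_nonneg y, norm_nonneg w]
    have h := weighted_eval_ge_near_max hp hwlt hy1 hmax
    -- Mesh `1 / (12 (m + 1))` makes `3m ‖y - w‖ ≤ 1/4`, and the denominator is at least `0.322`.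
    have h6 : 4 * ((3 * m : ℕ) : ℝ) ^ 2 * (‖y - w‖ ^ 2 / ((1 - ‖y‖ ^ 2) + (1 - ‖w‖ ^ 2))) ≤
        4 / 5 := by
      rw [← mul_div_assoc, div_le_iff₀ (by linarith)]
      have h7 : ((3 * m : ℕ) : ℝ) * ‖y - w‖ ≤ 1 / 4 := by
        push_cast
        have : (3 * m : ℝ) * ‖y - w‖ ≤ 3 * m * d := by gcongr
        nlinarith
      have h8 : (((3 * m : ℕ) : ℝ) * ‖y - w‖) ^ 2 ≤ (1 / 4) ^ 2 := by gcongr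
      rw [mul_assoc, ← mul_pow]
      linarith
    rw [← hM] at h
    have h9 : M * (1 / 5) ≤ |p y * (1 - ‖y‖ ^ 2) ^ m| :=
      (mul_le_mul_of_nonneg_left (by linarith) hM0).trans h
    rw [abs_mul, abs_of_nonneg (a := (1 - ‖y‖ ^ 2) ^ m) (pow_nonneg (by linarith) _)] at h9
    have h10 : (1 - ‖y‖ ^ 2) ^ m ≤ 1 := pow_le_one₀ (by linarith) (by nlinarith [norm_nonneg y])
    have h11 := hμ y hyS hy1
    have h12 : |p y| * (1 - ‖y‖ ^ 2) ^ m ≤ |p y| * 1 := by gcongr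
    linarith
  have hs31 : 1 ≤ Real.sqrt 3 := Real.one_le_sqrt.mpr (by norm_num)
  calc |p x| ≤ (3 * Real.sqrt 3 * κ) ^ m * M := hgrow κ x (by nlinarith) hx
    _ ≤ (3 * Real.sqrt 3 * κ) ^ m * (5 * μ) := by gcongr
    _ = _ := by ring

theorem linePoly_norming_ball [ProperSpace V] {k : ℕ} (hk : 1 ≤ k) {p : V → ℝ}
    (hp : p ∈ linePoly V k) {c : V} {R : ℝ} (hR : 0 < R) {Y : Set V} {d : ℝ}
    (hd : d * (12 * k) ≤ R) (hY : ∀ z ∈ Metric.closedBall c R, ∃ y ∈ Y, dist y z ≤ d) {μ : ℝ}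
    (hμ : ∀ y ∈ Y, y ∈ Metric.closedBall c R → |p y| ≤ μ) {κ : ℝ} (hκ : 1 ≤ κ) {x : V}
    (hx : dist x c ≤ κ * R) :
    |p x| ≤ 5 * (3 * Real.sqrt 3 * κ) ^ (k - 1) * μ := by
  obtain ⟨m, rfl⟩ : ∃ m, k = m + 1 := ⟨k - 1, by omega⟩
  have hn : ∀ v : V, ‖R • v‖ = R * ‖v‖ := fun v => by
    rw [norm_smul, Real.norm_eq_abs, abs_of_pos hR]
  have hinv : ∀ v : V, c + R • (R⁻¹ • (v - c)) = v := fun v => by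
    rw [smul_smul, mul_inv_cancel₀ hR.ne', one_smul, add_sub_cancel]
  have hni : ∀ v : V, ‖R⁻¹ • v‖ = R⁻¹ * ‖v‖ := fun v => by
    rw [norm_smul, Real.norm_eq_abs, abs_of_pos (inv_pos.mpr hR)]
  have h := linePoly_norming_unitBall (linePoly_comp_affine hp c R)
    (S := {v | c + R • v ∈ Y}) (d := d / R) (μ := μ) (κ := κ) (x := R⁻¹ • (x - c))
    (by rw [div_mul_eq_mul_div, div_le_one hR]; exact_mod_cast hd)
    (fun z hz => by
      obtain ⟨y, hy, hyz⟩ := hY (c + R • z) (by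
        rw [Metric.mem_closedBall, dist_eq_norm, add_sub_cancel_left, hn]; nlinarith)
      refine ⟨R⁻¹ • (y - c), by simpa only [mem_ofPred_eq, hinv], ?_⟩
      rw [le_div_iff₀ hR, mul_comm, ← hn, smul_sub, smul_smul, mul_inv_cancel₀ hR.ne', one_smul]
      rwa [dist_eq_norm, ← sub_sub] at hyz)
    (fun y hy hy1 => hμ _ hy (by
      rw [Metric.mem_closedBall, dist_eq_norm, add_sub_cancel_left, hn]; nlinarith))
    hκ (by rw [hni, inv_mul_le_iff₀ hR, ← dist_eq_norm, mul_comm]; exact hx)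
  simpa only [hinv, Nat.add_sub_cancel] using h

end Ball

/-! ### Norming sets in dimension one -/

theorem prod_erase_abs_sub_eq_factorial_mul (i r : ℕ) :
    ∏ j ∈ (Finset.range (i + 1 + r)).erase i, |(i : ℝ) - j| =
      (i.factorial : ℝ) * (r.factorial : ℝ) := by
  induction r with
  | zero =>
    have h : (Finset.range (i + 1 + 0)).erase i = Finset.range i := by
      ext j; simp only [Finset.mem_erase, Finset.mem_range]; omega
    rw [h, Nat.factorial_zero, Nat.cast_one, mul_one]
    clear h
    induction i with
    | zero => simp
    | succ i ih =>
      rw [Finset.prod_range_succ', Nat.factorial_succ]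
      push_cast
      simp only [add_sub_add_right_eq_sub, sub_zero]
      rw [ih, abs_of_nonneg (by positivity), mul_comm]
  | succ r ih =>
    have h : (Finset.range (i + 1 + (r + 1))).erase i =
        insert (i + 1 + r) ((Finset.range (i + 1 + r)).erase i) := by
      ext j; simp only [Finset.mem_erase, Finset.mem_range, Finset.mem_insert]; omega
    rw [h, Finset.prod_insert (by simp), ih, Nat.factorial_succ]
    push_cast
    rw [abs_of_nonpos (by linarith [(Nat.cast_nonneg r : (0 : ℝ) ≤ r)])]
    ring

/-- Lagrange interpolation at perturbed equispaced nodes. -/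
theorem abs_eval_le_of_equispaced {k : ℕ} (hk : 1 ≤ k) {P : Polynomial ℝ} (hP : P.degree < k)
    {R : ℝ} (hR : 0 < R) {t : ℕ → ℝ}
    (ht : ∀ i < k, |t i - (-R + (2 * i + 1) * (R / k))| ≤ R / k / 2) {μ : ℝ}
    (hμ : ∀ i < k, |P.eval (t i)| ≤ μ) {x : ℝ} (hx : |x| ≤ R) :
    |P.eval x| ≤ Real.exp (4 * k) * μ := by
  have hk0 : (0 : ℝ) < k := by exact_mod_cast hk
  have hμ0 : 0 ≤ μ := (abs_nonneg _).trans (hμ 0 hk)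
  set h := R / k with hh
  have hh0 : 0 < h := div_pos hR hk0
  have hhk : h * k = R := div_mul_cancel₀ _ hk0.ne'
  -- The ideal nodes are `2h` apart and each moves by at most `h / 2`, so a gap loses at most `h`.
  have hgap : ∀ i < k, ∀ j < k, i ≠ j → |(i : ℝ) - j| * h ≤ |t i - t j| := by
    intro i hi j hj hij
    have h1 := ht i hi
    have h2 := ht j hj
    have h3 : (1 : ℝ) ≤ |(i : ℝ) - j| := by
      have : (1 : ℤ) ≤ |(i : ℤ) - j| := Int.one_le_abs (sub_ne_zero.mpr (by exact_mod_cast hij))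
      exact_mod_cast this
    have h4 : (-R + (2 * i + 1) * h) - (-R + (2 * j + 1) * h) = 2 * ((i : ℝ) - j) * h := by ring
    have h5 : |(-R + (2 * i + 1) * h) - (-R + (2 * j + 1) * h)| = 2 * |(i : ℝ) - j| * h := by
      rw [h4, abs_mul, abs_mul, abs_of_pos hh0, abs_two]
    have h6 : (-R + (2 * i + 1) * h) - (-R + (2 * j + 1) * h) =
        (t i - t j) - (t i - (-R + (2 * i + 1) * h)) + (t j - (-R + (2 * j + 1) * h)) := by ring
    rw [h6] at h5
    have h7 := abs_add_le ((t i - t j) - (t i - (-R + (2 * i + 1) * h)))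
      (t j - (-R + (2 * j + 1) * h))
    have h8 := abs_sub (t i - t j) (t i - (-R + (2 * i + 1) * h))
    nlinarith
  have htR : ∀ i < k, |t i| ≤ R := by
    intro i hi
    have h1 := abs_le.mp (ht i hi)
    have h2 : (i : ℝ) + 1 ≤ k := by exact_mod_cast hi
    have h3 : (0 : ℝ) ≤ i := Nat.cast_nonneg i
    rw [abs_le]
    constructor <;> nlinarith [h1.1, h1.2]
  have hinj : Set.InjOn t (Finset.range k) := by
    intro i hi j hj hij
    by_contra hne
    have h1 := hgap i (Finset.mem_range.mp hi) j (Finset.mem_range.mp hj) hne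
    rw [hij, sub_self, abs_zero] at h1
    have : 0 < |(i : ℝ) - j| := abs_pos.mpr (sub_ne_zero.mpr (by exact_mod_cast hne))
    nlinarith
  have hP' := Lagrange.eq_interpolate hinj (by simpa using hP)
  have heval : P.eval x = ∑ i ∈ Finset.range k, P.eval (t i) *
      ∏ j ∈ (Finset.range k).erase i, ((t i - t j)⁻¹ * (x - t j)) := by
    conv_lhs => rw [hP', Lagrange.interpolate_apply, Polynomial.eval_finsetSum]
    refine Finset.sum_congr rfl fun i _ => ?_
    rw [Polynomial.eval_mul, Polynomial.eval_C, Lagrange.basis, Polynomial.eval_prod]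
    simp [Lagrange.basisDivisor]
  have hterm : ∀ i ∈ Finset.range k, |P.eval (t i) *
      ∏ j ∈ (Finset.range k).erase i, ((t i - t j)⁻¹ * (x - t j))| ≤
      μ * ((2 * k) ^ (k - 1) * ((k - 1).choose i / (k - 1).factorial)) := by
    intro i hi
    have hi' := Finset.mem_range.mp hi
    rw [abs_mul, Finset.abs_prod]
    refine mul_le_mul (hμ i hi') ?_ (Finset.prod_nonneg fun _ _ => abs_nonneg _) hμ0
    have h1 : ∀ j ∈ (Finset.range k).erase i,
        |(t i - t j)⁻¹ * (x - t j)| ≤ 2 * k * |(i : ℝ) - j|⁻¹ := by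
      intro j hj
      obtain ⟨hji, hj⟩ := Finset.mem_erase.mp hj
      have hj' := Finset.mem_range.mp hj
      have h2 := hgap i hi' j hj' hji.symm
      have h3 : 0 < |(i : ℝ) - j| := abs_pos.mpr (sub_ne_zero.mpr (by exact_mod_cast hji.symm))
      have h4 : |x - t j| ≤ 2 * R := by
        have := abs_sub x (t j)
        have := htR j hj'
        linarith
      rw [abs_mul, abs_inv]
      calc |t i - t j|⁻¹ * |x - t j| ≤ (|(i : ℝ) - j| * h)⁻¹ * (2 * R) := by gcongr
        _ = _ := by rw [← hhk]; field_simp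
    refine (Finset.prod_le_prod (fun _ _ => abs_nonneg _) h1).trans (le_of_eq ?_)
    rw [Finset.prod_mul_distrib, Finset.prod_const, Finset.card_erase_of_mem hi,
      Finset.card_range, Finset.prod_inv_distrib]
    congr 1
    obtain ⟨r, rfl⟩ : ∃ r, k = i + 1 + r := ⟨k - (i + 1), by omega⟩
    rw [prod_erase_abs_sub_eq_factorial_mul, show i + 1 + r - 1 = i + r by omega]
    have h5 : ((i + r).choose i : ℝ) * (i.factorial * r.factorial) = (i + r).factorial := by
      have := Nat.choose_mul_factorial_mul_factorial (Nat.le_add_right i r)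
      rw [Nat.add_sub_cancel_left] at this
      rw [← mul_assoc]
      exact_mod_cast this
    rw [← h5]
    have h6 : ((i + r).choose i : ℝ) ≠ 0 := by
      exact_mod_cast (Nat.choose_pos (Nat.le_add_right i r)).ne'
    field_simp
  rw [heval]
  refine (Finset.abs_sum_le_sum_abs _ _).trans ((Finset.sum_le_sum hterm).trans ?_)
  rw [← Finset.mul_sum, ← Finset.mul_sum, ← Finset.sum_div, mul_comm]
  gcongr
  have h7 : ∑ i ∈ Finset.range k, ((k - 1).choose i : ℝ) = 2 ^ (k - 1) := by
    have := Nat.sum_range_choose (k - 1)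
    rw [Nat.sub_add_cancel hk] at this
    exact_mod_cast this
  rw [h7]
  -- Summing the Lagrange basis bounds leaves a single term of the exponential series at `4k`.
  calc (2 * (k : ℝ)) ^ (k - 1) * (2 ^ (k - 1) / (k - 1).factorial)
      = (4 * k) ^ (k - 1) / (k - 1).factorial := by
        rw [← mul_div_assoc, ← mul_pow]; ring_nf
    _ ≤ Real.exp (4 * k) := Real.pow_div_factorial_le_exp _ (by positivity) _

/-! ### From norming sets to polynomial reproduction -/

/-- A norming inequality on a finite set yields a reproduction formula with controlled weights. -/
theorem exists_weights_of_norming {α : Type*} (V : Submodule ℝ (α → ℝ)) (Y : Finset α) (x : α)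
    {Λ : ℝ} (hΛ : 0 ≤ Λ)
    (h : ∀ p ∈ V, ∀ μ : ℝ, 0 ≤ μ → (∀ y ∈ Y, |p y| ≤ μ) → |p x| ≤ Λ * μ) :
    ∃ σ : α → ℝ, (∀ p ∈ V, p x = ∑ y ∈ Y, σ y * p y) ∧ ∑ y ∈ Y, |σ y| ≤ Λ := by
  classical
  let r : V →ₗ[ℝ] (Y → ℝ) :=
    { toFun := fun p y => p.1 y
      map_add' := fun _ _ => rfl
      map_smul' := fun _ _ => rfl }
  let ev : Module.Dual ℝ V :=
    { toFun := fun p => p.1 x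
      map_add' := fun _ _ => rfl
      map_smul' := fun _ _ => rfl }
  have hbound : ∀ p : V, |ev p| ≤ Λ * ‖r p‖ := fun p =>
    h p.1 p.2 _ (norm_nonneg _) fun y hy => norm_le_pi_norm (r p) ⟨y, hy⟩
  -- Evaluation at `x` vanishes on the kernel of restriction to `Y`, so it factors through the range
  -- of `r`. There it has norm at most `Λ` for the sup norm, and Hahn–Banach extends it to all of `Y
  -- → ℝ`.
  have hker : ev ∈ (LinearMap.ker r).dualAnnihilator := by
    rw [Submodule.mem_dualAnnihilator]
    intro p hp
    have h1 := hbound p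
    rw [LinearMap.mem_ker.mp hp, norm_zero, mul_zero] at h1
    exact abs_nonpos_iff.mp h1
  rw [← LinearMap.range_dualMap_eq_dualAnnihilator_ker] at hker
  obtain ⟨g, hg⟩ := hker
  have hg' : ∀ p : V, g (r p) = ev p := fun p => by rw [← hg]; rfl
  let g₁ : StrongDual ℝ (LinearMap.range r) :=
    (g.comp (LinearMap.range r).subtype).mkContinuous Λ (by
      rintro ⟨_, p, rfl⟩
      change |g (r p)| ≤ Λ * ‖r p‖
      rw [hg']
      exact hbound p)
  obtain ⟨G, hG, hGn⟩ := exists_extension_norm_eq (𝕜 := ℝ) (LinearMap.range r) g₁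
  have hGΛ : ‖G‖ ≤ Λ := hGn.trans_le (LinearMap.mkContinuous_norm_le _ hΛ _)
  have hGsum : ∀ v : Y → ℝ, G v = ∑ y : Y, G (Pi.single y 1) * v y := fun v => by
    conv_lhs => rw [pi_eq_sum_univ' v, map_sum]
    refine Finset.sum_congr rfl fun y _ => ?_
    rw [map_smul, smul_eq_mul, mul_comm]
  refine ⟨fun y => if hy : y ∈ Y then G (Pi.single ⟨y, hy⟩ 1) else 0, fun p hp => ?_, ?_⟩
  · have h1 : p x = G (r ⟨p, hp⟩) := by
      rw [hG ⟨r ⟨p, hp⟩, ⟨_, rfl⟩⟩]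
      exact (hg' ⟨p, hp⟩).symm
    rw [h1, hGsum, ← Finset.sum_coe_sort Y]
    refine Finset.sum_congr rfl fun y _ => ?_
    simp only [dif_pos y.2]
    rfl
  · rw [← Finset.sum_coe_sort Y]
    -- The `ℓ¹` norm of the weights is the value of `G` at their sign vector, whose sup norm is at
    -- most `1`.
    have h2 : ∑ y : Y, |if hy : (y : α) ∈ Y then G (Pi.single ⟨y, hy⟩ 1) else 0| =
        G fun y => SignType.sign (G (Pi.single y 1)) := by
      rw [hGsum]
      refine Finset.sum_congr rfl fun y _ => ?_
      rw [dif_pos y.2]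
      exact (self_mul_sign _).symm
    rw [h2]
    refine (le_abs_self _).trans ((G.le_opNorm _).trans ?_)
    refine (mul_le_of_le_one_right (norm_nonneg _) ?_).trans hGΛ
    refine (pi_norm_le_iff_of_nonneg zero_le_one).mpr fun y => ?_
    rcases lt_trichotomy (G (Pi.single y 1)) 0 with h | h | h <;> simp [h]

theorem two_le_gam {n : ℕ} (hn : 1 ≤ n) : 2 ≤ gam n := by
  obtain ⟨m, rfl⟩ : ∃ m, n = m + 1 := ⟨n - 1, by omega⟩
  rw [gam]
  nlinarith [Nat.zero_le (gam m), Nat.zero_le m]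

/-- The constant `12` is the mesh requirement of `linePoly_norming_ball`. In dimension one `γ₁ = 2`
falls short of it, which is why that case has its own argument. -/
theorem twelve_le_gam {n : ℕ} (hn : 2 ≤ n) : 12 ≤ gam n := by
  obtain ⟨m, rfl⟩ : ∃ m, n = m + 1 := ⟨n - 1, by omega⟩
  have h := two_le_gam (n := m) (by omega)
  rw [gam]
  nlinarith

/-- Very crude: `5` and `3√3√n` are each below `e^(24n)`, and there are `k` factors in all. -/
theorem norming_constant_le_exp {n k : ℕ} (hn : 2 ≤ n) (hk : 1 ≤ k) :
    5 * (3 * Real.sqrt 3 * Real.sqrt n) ^ (k - 1) ≤ Real.exp (2 * n * gam n * k) := by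
  have hn' : (2 : ℝ) ≤ n := by exact_mod_cast hn
  have hγ : (12 : ℝ) ≤ gam n := by exact_mod_cast twelve_le_gam hn
  have hk' : (1 : ℝ) ≤ k := by exact_mod_cast hk
  have h0 : 24 * (n : ℝ) ≤ 2 * n * gam n := by nlinarith
  have h1 : (3 * Real.sqrt 3 * Real.sqrt n) ≤ Real.exp (24 * n) := by
    have h2 := Real.add_one_le_exp (24 * (n : ℝ))
    have h3 : Real.sqrt 3 ≤ 2 := Real.sqrt_le_iff.mpr (by norm_num)
    have h4 : Real.sqrt n ≤ n := Real.sqrt_le_iff.mpr ⟨by linarith, by nlinarith⟩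
    have h5 : Real.sqrt 3 * Real.sqrt n ≤ 2 * n := by gcongr
    nlinarith
  have h6 : (5 : ℝ) ≤ Real.exp (24 * n) := by
    have h2 := Real.add_one_le_exp (24 * (n : ℝ))
    linarith
  calc 5 * (3 * Real.sqrt 3 * Real.sqrt n) ^ (k - 1)
      ≤ Real.exp (24 * n) * Real.exp (24 * n) ^ (k - 1) := by gcongr
    _ = Real.exp (24 * n * k) := by
        rw [← pow_succ', Nat.sub_add_cancel hk, ← Real.exp_nat_mul]; ring_nf
    _ ≤ _ := by gcongr

/-- Cut the interval into `k` equal pieces of length `2R / k`. The mesh `R / (2k)` puts a data point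
within a quarter of that length of each midpoint, as Lagrange interpolation needs. -/
theorem linePoly_norming_one {k : ℕ} (hk : 1 ≤ k) {p : EuclideanSpace ℝ (Fin 1) → ℝ}
    (hp : p ∈ linePoly (EuclideanSpace ℝ (Fin 1)) k) {c : EuclideanSpace ℝ (Fin 1)} {R : ℝ}
    (hR : 0 < R) {Y : Set (EuclideanSpace ℝ (Fin 1))} {d : ℝ} (hd : d * (2 * k) ≤ R)
    (hY : ∀ z ∈ Metric.closedBall c R, ∃ y ∈ Y, dist y z ≤ d) {μ : ℝ}
    (hμ : ∀ y ∈ Y, y ∈ Metric.closedBall c R → |p y| ≤ μ) {x : EuclideanSpace ℝ (Fin 1)}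
    (hx : dist x c ≤ R) : |p x| ≤ Real.exp (4 * k) * μ := by
  have hk0 : (0 : ℝ) < k := by exact_mod_cast hk
  set e : EuclideanSpace ℝ (Fin 1) := EuclideanSpace.single 0 1 with he
  have hline : ∀ v : EuclideanSpace ℝ (Fin 1), v = c + (v 0 - c 0) • e := fun v => by
    ext i
    fin_cases i
    simp [he]
  have hdist : ∀ v w : EuclideanSpace ℝ (Fin 1), dist v w = |v 0 - w 0| := fun v w => by
    rw [EuclideanSpace.dist_eq]
    simp [Real.sqrt_sq_eq_abs, Real.dist_eq]
  obtain ⟨P, hP, hPe⟩ := hp.2 c e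
  have hPv : ∀ v : EuclideanSpace ℝ (Fin 1), p v = P.eval (v 0 - c 0) := fun v => by
    conv_lhs => rw [hline v]
    exact hPe _
  have hh0 : 0 < R / k := div_pos hR hk0
  have hhk : R / k * k = R := div_mul_cancel₀ _ hk0.ne'
  have hc0 : ∀ s : ℝ, (c + s • e) 0 - c 0 = s := fun s => by simp [he]
  have hex : ∀ i : ℕ, ∃ y : EuclideanSpace ℝ (Fin 1), i < k →
      y ∈ Y ∧ |(y 0 - c 0) - (-R + (2 * i + 1) * (R / k))| ≤ R / k / 2 := fun i => by
    by_cases hi : i < k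
    · have h2 : (i : ℝ) + 1 ≤ k := by exact_mod_cast hi
      have h3 : (0 : ℝ) ≤ i := Nat.cast_nonneg i
      obtain ⟨y, hy, hyd⟩ := hY (c + (-R + (2 * i + 1) * (R / k)) • e) (by
        rw [Metric.mem_closedBall, hdist, hc0, abs_le]
        constructor <;> nlinarith)
      refine ⟨y, fun _ => ⟨hy, ?_⟩⟩
      rw [hdist] at hyd
      have h4 := hc0 (-R + (2 * i + 1) * (R / k))
      have h5 : (y 0 - c 0) - (-R + (2 * i + 1) * (R / k)) =
          y 0 - (c + (-R + (2 * i + 1) * (R / k)) • e) 0 := by linarith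
      rw [h5]
      refine hyd.trans ?_
      rw [div_div, le_div_iff₀ (by positivity)]
      linarith
    · exact ⟨c, fun h => absurd h hi⟩
  choose y hy using hex
  have hball : ∀ i < k, y i ∈ Metric.closedBall c R := fun i hi => by
    have h1 := abs_le.mp (hy i hi).2
    have h2 : (i : ℝ) + 1 ≤ k := by exact_mod_cast hi
    have h3 : (0 : ℝ) ≤ i := Nat.cast_nonneg i
    rw [Metric.mem_closedBall, hdist, abs_le]
    constructor <;> nlinarith [h1.1, h1.2]
  rw [hPv]
  exact abs_eval_le_of_equispaced hk hP hR (t := fun i => y i 0 - c 0) (fun i hi => (hy i hi).2)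
    (fun i hi => by rw [← hPv]; exact hμ _ (hy i hi).1 (hball i hi)) (by rwa [← hdist])

/-- Local polynomial reproduction from a sufficiently dense set of centres, with weights whose
absolute sum grows at most exponentially in the degree. -/
theorem exists_reproduction {n : ℕ} (hn : 1 ≤ n) {k : ℕ} (hk : 1 ≤ k)
    {c : EuclideanSpace ℝ (Fin n)} {R : ℝ} (hR : 0 < R) {X : Set (EuclideanSpace ℝ (Fin n))}
    {d : ℝ} (hd : d * (gam n * k) ≤ R)
    (hX : ∀ z ∈ Metric.closedBall c R, ∃ y ∈ X, dist z y < d) {x : EuclideanSpace ℝ (Fin n)}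
    (hx : dist x c ≤ Real.sqrt n * R) :
    ∃ (Y : Finset (EuclideanSpace ℝ (Fin n))) (σ : EuclideanSpace ℝ (Fin n) → ℝ),
      (Y : Set (EuclideanSpace ℝ (Fin n))) ⊆ X ∩ Metric.closedBall c R ∧
      (∀ p ∈ linePoly (EuclideanSpace ℝ (Fin n)) k, p x = ∑ y ∈ Y, σ y * p y) ∧
      ∑ y ∈ Y, |σ y| ≤ Real.exp (2 * n * gam n * k) := by
  classical
  -- The strict inequality in `hX` gives a cover by open balls, so compactness replaces `X` by a
  -- finite set without changing the mesh `d`.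
  obtain ⟨T, hTX, hTf, hT⟩ := (isCompact_closedBall c R).elim_finite_subcover_image (b := X)
    (c := fun y => Metric.ball y d) (fun _ _ => Metric.isOpen_ball) (fun z hz => by
      obtain ⟨y, hy, hzy⟩ := hX z hz
      exact mem_biUnion hy hzy)
  have hT' : ∀ z ∈ Metric.closedBall c R, ∃ y ∈ T, dist y z ≤ d := fun z hz => by
    obtain ⟨y, hy, hzy⟩ := mem_iUnion₂.mp (hT hz)
    exact ⟨y, hy, by rw [dist_comm]; exact (Metric.mem_ball.mp hzy).le⟩
  have hfin : (T ∩ Metric.closedBall c R).Finite := hTf.inter_of_left _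
  have hk0 : (0 : ℝ) ≤ k := Nat.cast_nonneg k
  have hd0 : 0 ≤ d := by
    obtain ⟨y, _, hy⟩ := hT' c (Metric.mem_closedBall_self hR.le)
    exact dist_nonneg.trans hy
  obtain ⟨σ, hσ, hσΛ⟩ := exists_weights_of_norming (linePoly (EuclideanSpace ℝ (Fin n)) k)
    hfin.toFinset x (Real.exp_pos (2 * n * gam n * k)).le (fun p hp μ hμ0 hμ => by
      have hμ' : ∀ y ∈ T, y ∈ Metric.closedBall c R → |p y| ≤ μ := fun y hy hyR =>
        hμ y (by simpa using ⟨hy, by simpa using hyR⟩)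
      rcases Nat.lt_or_ge 1 n with h2 | h1
      · have hγ : (12 : ℝ) ≤ gam n := by exact_mod_cast twelve_le_gam h2
        refine (linePoly_norming_ball hk hp hR (d := d) ?_ hT' hμ'
          (Real.one_le_sqrt.mpr (by exact_mod_cast hn)) hx).trans ?_
        · refine le_trans ?_ hd
          gcongr
        · gcongr
          exact norming_constant_le_exp h2 hk
      · obtain rfl : n = 1 := le_antisymm h1 hn
        have hg : (gam 1 : ℝ) = 2 := by simp [gam]
        rw [hg] at hd ⊢
        refine (linePoly_norming_one hk hp hR hd hT' hμ' (by simpa using hx)).trans (le_of_eq ?_)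
        norm_num)
  exact ⟨hfin.toFinset, σ, fun y hy => by
    rw [hfin.coe_toFinset] at hy
    exact ⟨hTX hy.1, hy.2⟩, hσ, hσΛ⟩

/-! ### The quadratic form of an annihilating functional -/

/-- The derivative of each Taylor remainder is minus the previous one, and the bounds integrate in
the same way; hence there is no extra exponential factor. -/
theorem abs_exp_neg_sub_sum_le (k : ℕ) : ∀ s : ℝ, 0 ≤ s →
    |Real.exp (-s) - ∑ j ∈ Finset.range k, (-s) ^ j / j.factorial| ≤ s ^ k / k.factorial := by
  induction k with
  | zero => intro s hs; simpa [abs_of_pos (Real.exp_pos _)] using hs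
  | succ k ih =>
    intro s hs
    have hsum : ∀ t : ℝ, HasDerivAt
        (fun t : ℝ => ∑ j ∈ Finset.range (k + 1), (-t) ^ j / (j.factorial : ℝ))
        (-∑ j ∈ Finset.range k, (-t) ^ j / j.factorial) t := fun t => by
      simp only [Finset.sum_range_succ', pow_zero, Nat.factorial_zero]
      refine HasDerivAt.add_const _ ?_
      rw [← Finset.sum_neg_distrib]
      refine HasDerivAt.fun_sum fun j _ => ?_
      have h := (((hasDerivAt_id t).neg).pow (j + 1)).div_const ((j + 1).factorial : ℝ)
      refine h.congr_deriv ?_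
      have : (j.factorial : ℝ) ≠ 0 := by exact_mod_cast j.factorial_ne_zero
      have h2 : (j : ℝ) + 1 ≠ 0 := by positivity
      simp only [Pi.neg_apply, id, Nat.factorial_succ]
      push_cast
      field_simp
    have hf : ∀ t : ℝ, HasDerivAt
        (fun t => Real.exp (-t) - ∑ j ∈ Finset.range (k + 1), (-t) ^ j / (j.factorial : ℝ))
        (-(Real.exp (-t) - ∑ j ∈ Finset.range k, (-t) ^ j / j.factorial)) t := fun t => by
      have h := ((hasDerivAt_id t).neg.exp).sub (hsum t)
      refine h.congr_deriv ?_
      simp only [Pi.neg_apply, id]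
      ring
    have hB : ∀ t : ℝ, HasDerivAt (fun t : ℝ => t ^ (k + 1) / ((k + 1).factorial : ℝ))
        (t ^ k / k.factorial) t := fun t => by
      refine ((hasDerivAt_pow (k + 1) t).div_const _).congr_deriv ?_
      have : (k.factorial : ℝ) ≠ 0 := by exact_mod_cast k.factorial_ne_zero
      have h2 : (k : ℝ) + 1 ≠ 0 := by positivity
      rw [Nat.factorial_succ, Nat.add_sub_cancel]
      push_cast
      field_simp
    have h := image_norm_le_of_norm_deriv_right_le_deriv_boundary (a := 0) (b := s)
      (fun t _ => (hf t).continuousAt.continuousWithinAt)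
      (fun t _ => (hf t).hasDerivWithinAt) (by simp [Finset.sum_range_succ']) hB
      (fun t ht => by rw [norm_neg]; exact ih t ht.1) (right_mem_Icc.mpr hs)
    exact h

section Annihilator

variable {V : Type*} [NormedAddCommGroup V] [InnerProductSpace ℝ V]

theorem normSq_pow_mul_inner_pow_mem_linePoly {k l e : ℕ} (h : 2 * l + e < k) (b : V) :
    (fun a : V => (‖a‖ ^ 2) ^ l * (inner ℝ a b) ^ e) ∈ linePoly V k := by
  refine ⟨by fun_prop, fun a u => ?_⟩
  refine ⟨(Polynomial.C (‖u‖ ^ 2) * Polynomial.X ^ 2 + Polynomial.C (2 * inner ℝ a u) *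
    Polynomial.X + Polynomial.C (‖a‖ ^ 2)) ^ l *
    (Polynomial.C (inner ℝ u b) * Polynomial.X + Polynomial.C (inner ℝ a b)) ^ e, ?_, fun t => ?_⟩
  · refine lt_of_le_of_lt (Polynomial.degree_le_of_natDegree_le (n := 2 * l + e) ?_)
      (by exact_mod_cast h)
    refine Polynomial.natDegree_mul_le.trans (add_le_add ?_ ?_)
    · exact Polynomial.natDegree_pow_le.trans
        ((Nat.mul_le_mul_left l Polynomial.natDegree_quadratic_le).trans (by omega))
    · exact Polynomial.natDegree_pow_le.trans
        ((Nat.mul_le_mul_left e Polynomial.natDegree_linear_le).trans (by omega))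
  · simp only [Polynomial.eval_mul, Polynomial.eval_pow, Polynomial.eval_add, Polynomial.eval_C,
      Polynomial.eval_X]
    rw [norm_add_sq_real, inner_add_left, real_inner_smul_left, real_inner_smul_right, norm_smul,
      Real.norm_eq_abs, mul_pow, sq_abs]
    ring_nf

theorem sum_sum_sum_rotate {ι κ : Type*} (T : Finset ι) (S : Finset κ) (F : ι → ι → κ → ℝ) :
    ∑ a ∈ T, ∑ b ∈ T, ∑ j ∈ S, F a b j = ∑ j ∈ S, ∑ a ∈ T, ∑ b ∈ T, F a b j := by
  rw [Finset.sum_comm (s := S)]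
  exact Finset.sum_congr rfl fun a _ => Finset.sum_comm

/-- Each monomial `‖a‖^(2l) ⟨a, b⟩^e ‖b‖^(2m)` with `l + e + m = j` has degrees `2l + e` in `a` and
`2m + e` in `b`, adding up to `2j < 2k`. One of them is below `k`, and summing over that variable
first gives zero. -/
theorem sum_sum_mul_dist_pow_eq_zero {k : ℕ} {T : Finset V} {τ : V → ℝ}
    (hτ : ∀ p ∈ linePoly V k, ∑ a ∈ T, τ a * p a = 0) {j : ℕ} (hj : j < k) :
    ∑ a ∈ T, ∑ b ∈ T, τ a * τ b * (‖a - b‖ ^ 2) ^ j = 0 := by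
  have hmono : ∀ l e m : ℕ, 2 * l + e < k ∨ 2 * m + e < k →
      ∑ a ∈ T, ∑ b ∈ T, τ a * τ b * ((‖a‖ ^ 2) ^ l * (inner ℝ a b) ^ e * (‖b‖ ^ 2) ^ m) = 0 := by
    rintro l e m (h | h)
    · rw [Finset.sum_comm]
      refine Finset.sum_eq_zero fun b _ => ?_
      have h1 := hτ _ (normSq_pow_mul_inner_pow_mem_linePoly h b)
      rw [← mul_zero (τ b * (‖b‖ ^ 2) ^ m), ← h1, Finset.mul_sum]
      exact Finset.sum_congr rfl fun a _ => by ring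
    · refine Finset.sum_eq_zero fun a _ => ?_
      have h1 := hτ _ (normSq_pow_mul_inner_pow_mem_linePoly h a)
      rw [← mul_zero (τ a * (‖a‖ ^ 2) ^ l), ← h1, Finset.mul_sum]
      exact Finset.sum_congr rfl fun b _ => by rw [real_inner_comm]; ring
  have hexp : ∀ a b : V, (‖a - b‖ ^ 2) ^ j = ∑ i ∈ Finset.range (j + 1),
      ∑ l ∈ Finset.range (i + 1), ((j.choose i : ℝ) * (i.choose l) * (-2) ^ (i - l)) *
        ((‖a‖ ^ 2) ^ l * (inner ℝ a b) ^ (i - l) * (‖b‖ ^ 2) ^ (j - i)) := fun a b => by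
    have h1 : ‖a - b‖ ^ 2 = (‖a‖ ^ 2 + (-2) * inner ℝ a b) + ‖b‖ ^ 2 := by
      rw [norm_sub_sq_real]; ring
    rw [h1, add_pow]
    refine Finset.sum_congr rfl fun i _ => ?_
    rw [add_pow, Finset.sum_mul, Finset.sum_mul]
    refine Finset.sum_congr rfl fun l _ => ?_
    rw [mul_pow]
    ring
  simp_rw [hexp, Finset.mul_sum]
  rw [sum_sum_sum_rotate]
  refine Finset.sum_eq_zero fun i hi => ?_
  rw [sum_sum_sum_rotate]
  refine Finset.sum_eq_zero fun l hl => ?_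
  have hi' := Finset.mem_range.mp hi
  have hl' := Finset.mem_range.mp hl
  have h := hmono l (i - l) (j - i) (by omega)
  rw [← mul_zero ((j.choose i : ℝ) * (i.choose l) * (-2) ^ (i - l)), ← h, Finset.mul_sum]
  refine Finset.sum_congr rfl fun a _ => ?_
  rw [Finset.mul_sum]
  exact Finset.sum_congr rfl fun b _ => by ring

theorem sum_sum_gaussian_le {k : ℕ} {T : Finset V} {τ : V → ℝ}
    (hτ : ∀ p ∈ linePoly V k, ∑ a ∈ T, τ a * p a = 0) {β r : ℝ} (hβ : 0 ≤ β)
    (hr : ∀ a ∈ T, ∀ b ∈ T, ‖a - b‖ ≤ r) :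
    ∑ a ∈ T, ∑ b ∈ T, τ a * τ b * Real.exp (-β * ‖a - b‖ ^ 2) ≤
      (∑ a ∈ T, |τ a|) ^ 2 * ((β * r ^ 2) ^ k / k.factorial) := by
  have hzero : ∑ a ∈ T, ∑ b ∈ T, τ a * τ b *
      ∑ j ∈ Finset.range k, (-(β * ‖a - b‖ ^ 2)) ^ j / j.factorial = 0 := by
    simp_rw [Finset.mul_sum]
    rw [sum_sum_sum_rotate]
    refine Finset.sum_eq_zero fun j hj => ?_
    have h := sum_sum_mul_dist_pow_eq_zero hτ (Finset.mem_range.mp hj)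
    rw [← mul_zero ((-β) ^ j / (j.factorial : ℝ)), ← h, Finset.mul_sum]
    refine Finset.sum_congr rfl fun a _ => ?_
    rw [Finset.mul_sum]
    refine Finset.sum_congr rfl fun b _ => ?_
    rw [← neg_mul, mul_pow]
    ring
  rw [← sub_zero (∑ a ∈ T, _), ← hzero, ← Finset.sum_sub_distrib, sq, Finset.sum_mul_sum,
    Finset.sum_mul]
  refine Finset.sum_le_sum fun a ha => ?_
  rw [← Finset.sum_sub_distrib, Finset.sum_mul]
  refine Finset.sum_le_sum fun b hb => ?_
  rw [← mul_sub, neg_mul]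
  have h1 := abs_exp_neg_sub_sum_le k (β * ‖a - b‖ ^ 2) (by positivity)
  have h2 : (β * ‖a - b‖ ^ 2) ^ k / (k.factorial : ℝ) ≤ (β * r ^ 2) ^ k / k.factorial := by
    have := hr a ha b hb
    gcongr
  refine (le_abs_self _).trans ?_
  rw [abs_mul, abs_mul]
  exact mul_le_mul_of_nonneg_left (h1.trans h2) (by positivity)

end Annihilator

/-! ### A feature map of the Gaussian kernel -/

/-- Bochner's representation: characters of frequency `√(2β) a` in `L²` of the standard Gaussian,
whose characteristic function `exp (-|t|² / 2)` returns the kernel. It turns quadratic forms into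
squared norms. -/
theorem exists_feature_map (n : ℕ) {β : ℝ} (hβ : 0 < β) :
    ∃ e : EuclideanSpace ℝ (Fin n) →
        Lp ℂ 2 (ProbabilityTheory.stdGaussian (EuclideanSpace ℝ (Fin n))),
      ∀ a b, inner ℂ (e b) (e a) = gaussian n β (a - b) := by
  set μ := ProbabilityTheory.stdGaussian (EuclideanSpace ℝ (Fin n))
  set g : EuclideanSpace ℝ (Fin n) → EuclideanSpace ℝ (Fin n) → ℂ := fun a ξ =>
    Complex.exp (((inner ℝ ξ (Real.sqrt (2 * β) • a) : ℝ) : ℂ) * Complex.I) with hg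
  have hmem : ∀ a, MemLp (g a) 2 μ := fun a =>
    MemLp.of_bound (Continuous.aestronglyMeasurable (by fun_prop)) 1
      (Filter.Eventually.of_forall fun ξ => by
        rw [hg, Complex.norm_exp_ofReal_mul_I])
  refine ⟨fun a => (hmem a).toLp, fun a b => ?_⟩
  rw [L2.inner_def]
  have h1 : (fun ξ => inner ℂ (((hmem b).toLp (g b) : Lp ℂ 2 μ) ξ) (((hmem a).toLp (g a) : Lp ℂ 2 μ) ξ)) =ᵐ[μ]
      fun ξ => Complex.exp (((inner ℝ ξ (Real.sqrt (2 * β) • (a - b)) : ℝ) : ℂ) * Complex.I) := by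
    filter_upwards [(hmem a).coeFn_toLp, (hmem b).coeFn_toLp] with ξ ha hb
    rw [ha, hb, RCLike.inner_apply, hg]
    simp only
    rw [← Complex.exp_conj, ← Complex.exp_add]
    congr 1
    rw [smul_sub, inner_sub_right]
    simp only [map_mul, Complex.conj_ofReal, Complex.conj_I]
    push_cast
    ring
  rw [integral_congr_ae h1, ← charFun_apply, ProbabilityTheory.charFun_stdGaussian, gaussian,
    norm_smul, Real.norm_eq_abs, abs_of_nonneg (Real.sqrt_nonneg _)]
  push_cast
  congr 1
  have h2 : ((Real.sqrt (2 * β) : ℝ) : ℂ) ^ 2 = 2 * β := by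
    rw [← Complex.ofReal_pow, Real.sq_sqrt (by positivity)]
    push_cast; rfl
  rw [mul_pow, h2]
  ring

/-! ### Native bounds extend to finitely supported measures -/

section Mollify

variable {n : ℕ}

/-- A bump function at `a` supported in the ball of radius `1 / (N + 1)`. -/
noncomputable def bumpAt (a : EuclideanSpace ℝ (Fin n)) (N : ℕ) : ContDiffBump a where
  rIn := 1 / (2 * ((N : ℝ) + 1))
  rOut := 1 / ((N : ℝ) + 1)
  rIn_pos := by positivity
  rIn_lt_rOut := by
    apply one_div_lt_one_div_of_lt <;> linarith [(Nat.cast_nonneg N : (0 : ℝ) ≤ N)]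

/-- An approximate identity at `a`, as a complex-valued function. -/
noncomputable def moll (a : EuclideanSpace ℝ (Fin n)) (N : ℕ) (x : EuclideanSpace ℝ (Fin n)) : ℂ :=
  (((bumpAt a N).normed volume x : ℝ) : ℂ)

theorem contDiff_moll (a : EuclideanSpace ℝ (Fin n)) (N : ℕ) : ContDiff ℝ ∞ (moll a N) :=
  Complex.ofRealCLM.contDiff.comp (bumpAt a N).contDiff_normed

theorem hasCompactSupport_moll (a : EuclideanSpace ℝ (Fin n)) (N : ℕ) :
    HasCompactSupport (moll a N) :=
  ((bumpAt a N).hasCompactSupport_normed (μ := volume)).comp_left Complex.ofReal_zero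

theorem integrable_mul_moll {K : EuclideanSpace ℝ (Fin n) → ℂ} (hK : Continuous K)
    (a : EuclideanSpace ℝ (Fin n)) (N : ℕ) : Integrable (fun x => K x * moll a N x) :=
  (hK.mul (contDiff_moll a N).continuous).integrable_of_hasCompactSupport
    (hasCompactSupport_moll a N).mul_left

/-- The mollifier is a probability density on a small ball, so the integral is an average of values
near `v`. Applied twice, it also handles the double integral of the kernel. -/
theorem norm_integral_mul_moll_sub_le {K : EuclideanSpace ℝ (Fin n) → ℂ} (hK : Continuous K)
    {a : EuclideanSpace ℝ (Fin n)} {N : ℕ} {v : ℂ} {δ : ℝ}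
    (hv : ∀ x, dist x a < 1 / ((N : ℝ) + 1) → ‖K x - v‖ ≤ δ) :
    ‖(∫ x, K x * moll a N x) - v‖ ≤ δ := by
  have h1 : ∫ x, moll a N x = 1 := by
    simp only [moll]
    rw [integral_complex_ofReal, (bumpAt a N).integral_normed, Complex.ofReal_one]
  have h2 : (∫ x, K x * moll a N x) - v = ∫ x, (K x - v) * moll a N x := by
    simp_rw [sub_mul]
    rw [integral_sub (integrable_mul_moll hK a N) (integrable_mul_moll continuous_const a N),
      integral_const_mul, h1, mul_one]
  rw [h2]
  have h3 : ∀ x, ‖(K x - v) * moll a N x‖ ≤ δ * (bumpAt a N).normed volume x := fun x => by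
    have hnn := (bumpAt a N).nonneg_normed (μ := volume) x
    rw [norm_mul, moll, Complex.norm_real, Real.norm_eq_abs, abs_of_nonneg hnn]
    by_cases hx : x ∈ Function.support ((bumpAt a N).normed volume)
    · rw [ContDiffBump.support_normed_eq] at hx
      exact mul_le_mul_of_nonneg_right (hv x hx) hnn
    · rw [Function.notMem_support.mp hx, mul_zero, mul_zero]
  refine (norm_integral_le_of_norm_le ((bumpAt a N).integrable_normed.const_mul δ)
    (Filter.Eventually.of_forall h3)).trans (le_of_eq ?_)
  rw [integral_const_mul, (bumpAt a N).integral_normed, mul_one]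

theorem tendsto_integral_mul_moll {f : EuclideanSpace ℝ (Fin n) → ℂ} (hf : Continuous f)
    (a : EuclideanSpace ℝ (Fin n)) :
    Filter.Tendsto (fun N => ∫ x, f x * moll a N x) Filter.atTop (nhds (f a)) := by
  rw [Metric.tendsto_atTop]
  intro ε hε
  obtain ⟨r, hr, hfr⟩ := Metric.continuousAt_iff.mp hf.continuousAt (ε / 2) (half_pos hε)
  obtain ⟨N₀, hN₀⟩ := exists_nat_one_div_lt hr
  refine ⟨N₀, fun N hN => ?_⟩
  rw [dist_eq_norm]
  refine lt_of_le_of_lt (norm_integral_mul_moll_sub_le hf (δ := ε / 2) fun x hx => ?_)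
    (half_lt_self hε)
  rw [← dist_eq_norm]
  exact (hfr (lt_of_lt_of_le hx ((Nat.one_div_le_one_div hN).trans hN₀.le))).le

theorem continuous_integral_sub_mul_moll {h : EuclideanSpace ℝ (Fin n) → ℂ} (hh : Continuous h)
    (b : EuclideanSpace ℝ (Fin n)) (N : ℕ) :
    Continuous fun x => ∫ y, h (x - y) * moll b N y := by
  have h1 := (hasCompactSupport_moll b N).continuous_convolution_left
    (ContinuousLinearMap.mul ℝ ℂ) (μ := volume) (contDiff_moll b N).continuous
    hh.locallyIntegrable
  refine h1.congr fun x => ?_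
  simp only [convolution_def, ContinuousLinearMap.mul_apply']
  exact integral_congr_ae (Filter.Eventually.of_forall fun y => mul_comm _ _)

theorem tendsto_double_integral_moll {h : EuclideanSpace ℝ (Fin n) → ℂ} (hh : Continuous h)
    (a b : EuclideanSpace ℝ (Fin n)) :
    Filter.Tendsto (fun N => ∫ x, (∫ y, h (x - y) * moll b N y) * moll a N x) Filter.atTop
      (nhds (h (a - b))) := by
  rw [Metric.tendsto_atTop]
  intro ε hε
  obtain ⟨r, hr, hfr⟩ := Metric.continuousAt_iff.mp (hh.continuousAt (x := a - b)) (ε / 2)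
    (half_pos hε)
  obtain ⟨N₀, hN₀⟩ := exists_nat_one_div_lt (half_pos hr)
  refine ⟨N₀, fun N hN => ?_⟩
  rw [dist_eq_norm]
  have hN' : 1 / ((N : ℝ) + 1) < r / 2 := (Nat.one_div_le_one_div hN).trans_lt hN₀
  refine lt_of_le_of_lt (norm_integral_mul_moll_sub_le
    (continuous_integral_sub_mul_moll hh b N) (δ := ε / 2) fun x hx => ?_) (half_lt_self hε)
  refine norm_integral_mul_moll_sub_le (hh.comp (continuous_sub_left x)) fun y hy => ?_
  rw [Function.comp, ← dist_eq_norm]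
  refine (hfr ?_).le
  have := dist_sub_sub_le x y a b
  linarith

theorem isTestFunction_sum_moll (T : Finset (EuclideanSpace ℝ (Fin n)))
    (τ : EuclideanSpace ℝ (Fin n) → ℂ) (N : ℕ) :
    IsTestFunction fun x => ∑ a ∈ T, τ a * moll a N x := by
  refine ⟨ContDiff.sum fun a _ => contDiff_const.mul (contDiff_moll a N), ?_⟩
  induction T using Finset.cons_induction with
  | empty =>
    simp only [Finset.sum_empty]
    exact HasCompactSupport.zero
  | cons a T ha ih =>
    simp only [Finset.sum_cons]
    exact ((hasCompactSupport_moll a N).mul_left).add ih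

theorem quadForm_sum_moll {h : EuclideanSpace ℝ (Fin n) → ℂ} (hh : Continuous h)
    (T : Finset (EuclideanSpace ℝ (Fin n))) (τ : EuclideanSpace ℝ (Fin n) → ℂ) (N : ℕ) :
    quadForm h (fun x => ∑ a ∈ T, τ a * moll a N x) =
      (∑ a ∈ T, ∑ b ∈ T, τ a * conj (τ b) *
        ∫ x, (∫ y, h (x - y) * moll b N y) * moll a N x).re := by
  have hconj : ∀ (b y : EuclideanSpace ℝ (Fin n)), conj (moll b N y) = moll b N y :=
    fun b y => Complex.conj_ofReal _
  have hin : ∀ x, ∫ y, h (x - y) * (∑ a ∈ T, τ a * moll a N x) *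
      conj (∑ a ∈ T, τ a * moll a N y) =
      ∑ a ∈ T, ∑ b ∈ T, τ a * conj (τ b) * ((∫ y, h (x - y) * moll b N y) * moll a N x) := by
    intro x
    have h1 : ∀ y, h (x - y) * (∑ a ∈ T, τ a * moll a N x) * conj (∑ a ∈ T, τ a * moll a N y) =
        ∑ b ∈ T, (∑ a ∈ T, τ a * moll a N x) * conj (τ b) * (h (x - y) * moll b N y) := fun y => by
      rw [map_sum, Finset.mul_sum]
      refine Finset.sum_congr rfl fun b _ => ?_
      rw [map_mul, hconj]
      ring
    have h2 : ∀ b, Integrable fun y => h (x - y) * moll b N y := fun b =>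
      integrable_mul_moll (hh.comp (continuous_sub_left x)) b N
    simp_rw [h1]
    rw [integral_finsetSum _ fun b _ => (h2 b).const_mul _, Finset.sum_comm]
    refine Finset.sum_congr rfl fun b _ => ?_
    rw [integral_const_mul, Finset.sum_mul, Finset.sum_mul]
    exact Finset.sum_congr rfl fun a _ => by ring
  rw [quadForm]
  simp_rw [hin]
  have hint : ∀ a b, Integrable fun x => (∫ y, h (x - y) * moll b N y) * moll a N x := fun a b =>
    integrable_mul_moll (continuous_integral_sub_mul_moll hh b N) a N
  rw [integral_finsetSum _ fun a _ => integrable_finsetSum _ fun b _ => (hint a b).const_mul _]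
  congr 1
  refine Finset.sum_congr rfl fun a _ => ?_
  rw [integral_finsetSum _ fun b _ => (hint a b).const_mul _]
  exact Finset.sum_congr rfl fun b _ => integral_const_mul _ _

/-- A native bound on test functions extends to finite combinations of point evaluations. -/
theorem IsNativeBound.norm_sum_le {h f : EuclideanSpace ℝ (Fin n) → ℂ} (hh : Continuous h)
    (hf : Continuous f) {c : ℝ} (hc : IsNativeBound h f c)
    (T : Finset (EuclideanSpace ℝ (Fin n))) (τ : EuclideanSpace ℝ (Fin n) → ℂ) :
    ‖∑ a ∈ T, τ a * f a‖ ≤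
      c * Real.sqrt (∑ a ∈ T, ∑ b ∈ T, τ a * conj (τ b) * h (a - b)).re := by
  have h1 : Filter.Tendsto (fun N => ‖∫ x, f x * ∑ a ∈ T, τ a * moll a N x‖) Filter.atTop
      (nhds ‖∑ a ∈ T, τ a * f a‖) := by
    have h2 : ∀ N, ∫ x, f x * ∑ a ∈ T, τ a * moll a N x =
        ∑ a ∈ T, τ a * ∫ x, f x * moll a N x := fun N => by
      simp_rw [Finset.mul_sum, mul_left_comm (f _)]
      rw [integral_finsetSum _ fun a _ => (integrable_mul_moll hf a N).const_mul _]
      exact Finset.sum_congr rfl fun a _ => integral_const_mul _ _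
    simp_rw [h2]
    exact (tendsto_finsetSum _ fun a _ => (tendsto_integral_mul_moll hf a).const_mul _).norm
  have h3 : Filter.Tendsto (fun N => c * Real.sqrt (quadForm h fun x => ∑ a ∈ T, τ a * moll a N x))
      Filter.atTop (nhds (c * Real.sqrt
        (∑ a ∈ T, ∑ b ∈ T, τ a * conj (τ b) * h (a - b)).re)) := by
    simp_rw [quadForm_sum_moll hh]
    refine Filter.Tendsto.const_mul _ ((Real.continuous_sqrt.tendsto _).comp
      ((Complex.continuous_re.tendsto _).comp ?_))
    exact tendsto_finsetSum _ fun a _ => tendsto_finsetSum _ fun b _ =>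
      (tendsto_double_integral_moll hh a b).const_mul _
  exact le_of_tendsto_of_tendsto' h1 h3 fun N => hc.2 _ (isTestFunction_sum_moll T τ N)

end Mollify

theorem nativeNorm_nonneg {n : ℕ} (h f : EuclideanSpace ℝ (Fin n) → ℂ) : 0 ≤ nativeNorm h f :=
  Real.sInf_nonneg fun _ hc => hc.1

theorem MemNative.isNativeBound_nativeNorm {n : ℕ} {h f : EuclideanSpace ℝ (Fin n) → ℂ}
    (hf : MemNative h f) : IsNativeBound h f (nativeNorm h f) := by
  refine ⟨nativeNorm_nonneg h f, fun φ hφ => ?_⟩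
  obtain ⟨c, hc⟩ := hf.2
  -- Where the form vanishes one cannot divide, but there any admissible constant forces the
  -- integral to be zero.
  rcases (Real.sqrt_nonneg (quadForm h φ)).eq_or_lt with h0 | h0
  · have := hc.2 φ hφ
    rw [← h0, mul_zero] at this ⊢
    exact this
  · rw [← div_le_iff₀ h0]
    exact le_csInf ⟨c, hc⟩ fun c' hc' => (div_le_iff₀ h0).mpr (hc'.2 φ hφ)

theorem continuous_gaussian (n : ℕ) (β : ℝ) : Continuous (gaussian n β) := by
  unfold gaussian
  fun_prop

/-! ### Interpolation error in terms of the quadratic form -/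

/-- The error of a spline at any finite combination of point evaluations is controlled by the
native norm of the interpolated function. -/
theorem norm_sum_mul_sub_spline_le {n : ℕ} {β : ℝ} (hβ : 0 < β)
    {X : Set (EuclideanSpace ℝ (Fin n))} {f s : EuclideanSpace ℝ (Fin n) → ℂ}
    (hf : MemNative (gaussian n β) f) (hs : IsSpline (gaussian n β) X f s)
    (T : Finset (EuclideanSpace ℝ (Fin n))) (τ : EuclideanSpace ℝ (Fin n) → ℂ) :
    ‖∑ a ∈ T, τ a * (f a - s a)‖ ≤ 2 * nativeNorm (gaussian n β) f *
      Real.sqrt (∑ a ∈ T, ∑ b ∈ T, τ a * conj (τ b) * gaussian n β (a - b)).re := by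
  classical
  have hfb := hf.isNativeBound_nativeNorm
  have hnn := nativeNorm_nonneg (gaussian n β) f
  rcases hs with hs | ⟨hsN, hsX, hmin⟩
  · obtain ⟨S, c, hSX, hsum, heq⟩ := hs
    obtain ⟨e, he⟩ := exists_feature_map n hβ
    have hquad : ∀ (T : Finset (EuclideanSpace ℝ (Fin n))) (τ : EuclideanSpace ℝ (Fin n) → ℂ),
        (∑ a ∈ T, ∑ b ∈ T, τ a * conj (τ b) * gaussian n β (a - b)).re =
          ‖∑ a ∈ T, τ a • e a‖ ^ 2 := fun T τ => by
      rw [← inner_self_eq_norm_sq (𝕜 := ℂ), sum_inner, Finset.sum_comm]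
      simp only [inner_sum, inner_smul_left, inner_smul_right, he]
      change Complex.re _ = Complex.re _
      congr 1
      refine Finset.sum_congr rfl fun b _ => Finset.sum_congr rfl fun a _ => by ring
    have hpt : ∀ (T : Finset (EuclideanSpace ℝ (Fin n))) (τ : EuclideanSpace ℝ (Fin n) → ℂ),
        ‖∑ a ∈ T, τ a * f a‖ ≤ nativeNorm (gaussian n β) f * ‖∑ a ∈ T, τ a • e a‖ := fun T τ => by
      have := hfb.norm_sum_le (continuous_gaussian n β) hf.1 T τ
      rwa [hquad, Real.sqrt_sq (norm_nonneg _)] at this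
    rw [hquad, Real.sqrt_sq (norm_nonneg _)]
    set W := ∑ b ∈ S, conj (c b) • e b with hW
    set U := ∑ a ∈ T, τ a • e a with hU
    have hsW : ∀ a, s a = inner ℂ W (e a) := fun a => by
      rw [hsum, hW, sum_inner]
      refine Finset.sum_congr rfl fun b _ => ?_
      rw [inner_smul_left, he, Complex.conj_conj]
    have hsU : ∑ a ∈ T, τ a * s a = inner ℂ W U := by
      rw [hU, inner_sum]
      exact Finset.sum_congr rfl fun a _ => by rw [inner_smul_right, hsW]
    -- Subtract from `U` its projection onto the vector `W` that represents `s`. The new functional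
    -- kills `s`, has no larger norm, and agrees with the old one on `f - s`, because only
    -- evaluations on `S`, where `f = s`, were added. If `W = 0`, division by zero gives `lam = 0`,
    -- which is harmless.
    set lam : ℂ := inner ℂ W U / inner ℂ W W with hlam
    set τ' : EuclideanSpace ℝ (Fin n) → ℂ := fun a =>
      (if a ∈ T then τ a else 0) - lam * (if a ∈ S then conj (c a) else 0) with hτ'
    have hsplit : ∀ g : EuclideanSpace ℝ (Fin n) → ℂ, ∑ a ∈ T ∪ S, τ' a * g a =
        ∑ a ∈ T, τ a * g a - lam * ∑ a ∈ S, conj (c a) * g a := fun g => by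
      simp only [hτ', sub_mul, Finset.sum_sub_distrib, mul_assoc, ← Finset.mul_sum, ite_mul,
        zero_mul]
      rw [Finset.sum_ite_mem, Finset.sum_ite_mem, Finset.union_inter_cancel_left,
        Finset.union_inter_cancel_right]
    have hsplit' : ∑ a ∈ T ∪ S, τ' a • e a = U - lam • W := by
      simp only [hτ', sub_smul, Finset.sum_sub_distrib, mul_smul, ← Finset.smul_sum, ite_smul,
        zero_smul]
      rw [Finset.sum_ite_mem, Finset.sum_ite_mem, Finset.union_inter_cancel_left,
        Finset.union_inter_cancel_right]
    have hS0 : ∑ a ∈ S, conj (c a) * (f a - s a) = 0 := Finset.sum_eq_zero fun a ha => by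
      rw [heq (hSX ▸ Finset.mem_coe.mpr ha), sub_self, mul_zero]
    have horth : inner ℂ W (U - lam • W) = 0 := by
      rw [inner_sub_right, inner_smul_right, hlam]
      rcases eq_or_ne W 0 with h0 | h0
      · simp [h0]
      · rw [div_mul_cancel₀ _ (inner_self_ne_zero.mpr h0), sub_self]
    have hsT' : ∑ a ∈ T ∪ S, τ' a * s a = 0 := by
      rw [← horth, ← hsplit', inner_sum]
      exact Finset.sum_congr rfl fun a _ => by rw [inner_smul_right, hsW]
    have hval : ∑ a ∈ T, τ a * (f a - s a) = ∑ a ∈ T ∪ S, τ' a * f a := by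
      have h1 := hsplit fun a => f a - s a
      rw [hS0, mul_zero, sub_zero] at h1
      rw [← h1]
      simp only [mul_sub, Finset.sum_sub_distrib, hsT', sub_zero]
    have hnorm : ‖U - lam • W‖ ≤ ‖U‖ := by
      have h1 : ‖U‖ ^ 2 = ‖U - lam • W‖ ^ 2 + ‖lam • W‖ ^ 2 := by
        have h2 : inner ℂ (U - lam • W) (lam • W) = 0 := by
          rw [inner_smul_right, ← inner_conj_symm, horth, map_zero, mul_zero]
        have h3 := norm_add_sq_eq_norm_sq_add_norm_sq_of_inner_eq_zero _ _ h2
        rw [sub_add_cancel] at h3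
        simpa [sq] using h3
      exact (sq_le_sq₀ (norm_nonneg _) (norm_nonneg _)).mp (by nlinarith [sq_nonneg ‖lam • W‖])
    rw [hval]
    refine (hpt _ _).trans ?_
    rw [hsplit']
    calc _ ≤ nativeNorm (gaussian n β) f * ‖U‖ := by gcongr
      _ ≤ _ := by nlinarith [mul_nonneg hnn (norm_nonneg U)]
  -- Since `f` interpolates itself, minimality bounds the norm of `s` by that of `f`; the triangle
  -- inequality then costs the factor `2`.
  · have hle := hmin f hf fun _ _ => rfl
    have h1 := hfb.norm_sum_le (continuous_gaussian n β) hf.1 T τ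
    have h2 := hsN.isNativeBound_nativeNorm.norm_sum_le (continuous_gaussian n β) hsN.1 T τ
    simp only [mul_sub, Finset.sum_sub_distrib]
    refine (norm_sub_le _ _).trans ?_
    have h3 := mul_le_mul_of_nonneg_right hle (Real.sqrt_nonneg
      (∑ a ∈ T, ∑ b ∈ T, τ a * conj (τ b) * gaussian n β (a - b)).re)
    linarith

/-! ### Cubes -/

/-- Every point of a cube of side `b ≥ b₀` lies in a subcube of side `b₀`; here only the centre of
that subcube and its inscribed ball are recorded. -/
theorem IsCube.exists_center {n : ℕ} {b b₀ : ℝ} (hb₀ : 0 < b₀) (hb : b₀ ≤ b)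
    {E : Set (EuclideanSpace ℝ (Fin n))} (hE : IsCube b E) {x : EuclideanSpace ℝ (Fin n)}
    (hx : x ∈ E) : ∃ c, dist x c ≤ Real.sqrt n * (b₀ / 2) ∧ Metric.closedBall c (b₀ / 2) ⊆ E := by
  obtain ⟨Φ, rfl⟩ := hE
  obtain ⟨v, hv, rfl⟩ := hx
  -- The centre is `v` with each coordinate clamped to `[b₀/2, b - b₀/2]`.
  set w : EuclideanSpace ℝ (Fin n) :=
    WithLp.toLp 2 fun i => max (b₀ / 2) (min (v i) (b - b₀ / 2)) with hw
  have hwi : ∀ i, w i = max (b₀ / 2) (min (v i) (b - b₀ / 2)) := fun i => rfl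
  have hw1 : ∀ i, b₀ / 2 ≤ w i := fun i => le_max_left _ _
  have hw2 : ∀ i, w i ≤ b - b₀ / 2 := fun i => max_le (by linarith) (min_le_right _ _)
  have hvw : ∀ i, |v i - w i| ≤ b₀ / 2 := fun i => by
    obtain ⟨h1, h2⟩ := hv i
    rw [hwi, abs_le]
    rcases max_cases (b₀ / 2) (min (v i) (b - b₀ / 2)) with h | h <;>
    rcases min_cases (v i) (b - b₀ / 2) with h' | h' <;>
    constructor <;> linarith [h.1, h.2, h'.1, h'.2]
  refine ⟨Φ w, ?_, fun z hz => ⟨Φ.symm z, fun i => ?_, Φ.apply_symm_apply z⟩⟩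
  · rw [Φ.dist_map, EuclideanSpace.dist_eq]
    refine Real.sqrt_le_iff.mpr ⟨by positivity, ?_⟩
    rw [mul_pow, Real.sq_sqrt (Nat.cast_nonneg n)]
    calc ∑ i, dist (v i) (w i) ^ 2 ≤ ∑ _i : Fin n, (b₀ / 2) ^ 2 := by
          refine Finset.sum_le_sum fun i _ => ?_
          rw [Real.dist_eq]
          exact pow_le_pow_left₀ (abs_nonneg _) (hvw i) 2
      _ = n * (b₀ / 2) ^ 2 := by simp
  · have h1 : dist (Φ.symm z) w ≤ b₀ / 2 := by
      rw [← Φ.dist_map, Φ.apply_symm_apply]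
      exact hz
    have h2 : |Φ.symm z i - w i| ≤ b₀ / 2 := by
      rw [dist_eq_norm] at h1
      exact (PiLp.norm_apply_le (Φ.symm z - w) i).trans h1
    rw [abs_le] at h2
    constructor <;> linarith [hw1 i, hw2 i, h2.1, h2.2]

theorem exists_dist_lt_of_fillDist {n : ℕ} {A X : Set (EuclideanSpace ℝ (Fin n))} {d d' : ℝ}
    (h : fillDist A X = ENNReal.ofReal d) (hd : 0 < d) (hdd : d < d')
    {z : EuclideanSpace ℝ (Fin n)} (hz : z ∈ A) : ∃ y ∈ X, dist z y < d' := by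
  have h1 : ⨅ y ∈ X, edist z y < ENNReal.ofReal d' := by
    refine lt_of_le_of_lt ?_ ((ENNReal.ofReal_lt_ofReal_iff (hd.trans hdd)).mpr hdd)
    rw [← h]
    exact le_iSup₂ (f := fun z (_ : z ∈ A) => ⨅ y ∈ X, edist z y) z hz
  simp only [iInf_lt_iff] at h1
  obtain ⟨y, hy, hzy⟩ := h1
  exact ⟨y, hy, edist_lt_ofReal.mp hzy⟩

/-! ### The constants -/

theorem half_le_rho : 1 / 2 ≤ rho := by
  have h1 := Real.exp_one_lt_d9
  have h2 : (1.7 : ℝ) ≤ Real.sqrt 3 := Real.le_sqrt_of_sq_le (by norm_num)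
  rw [rho, div_le_div_iff₀ (by norm_num) (Real.exp_pos 1)]
  linarith

/-- Equality for even `n`; for odd `n` the argument is rounded up by `1/2`. Monotonicity of `Γ` is
used from `2` on, so `n = 1` is computed directly. -/
theorem Gamma_half_add_one_le {n : ℕ} (hn : 1 ≤ n) :
    Real.Gamma ((n : ℝ) / 2 + 1) ≤ (((n - 1) / 2 + 1).factorial : ℝ) := by
  rw [← Real.Gamma_nat_eq_factorial]
  rcases Nat.even_or_odd' n with ⟨l, rfl | rfl⟩
  · obtain ⟨m, rfl⟩ : ∃ m, l = m + 1 := ⟨l - 1, by omega⟩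
    rw [show (2 * (m + 1) - 1) / 2 = m by omega]
    refine le_of_eq ?_
    congr 1
    push_cast
    ring
  · rw [show (2 * l + 1 - 1) / 2 = l by omega]
    rcases Nat.eq_zero_or_pos l with rfl | hl
    · have h1 : Real.sqrt Real.pi ≤ 2 := Real.sqrt_le_iff.mpr ⟨by norm_num, by
        linarith [Real.pi_le_four]⟩
      have h2 := Real.Gamma_add_one (s := 1 / 2) (by norm_num)
      rw [Real.Gamma_one_half_eq] at h2
      norm_num [Real.Gamma_two] at h2 ⊢
      linarith
    · have hl' : (1 : ℝ) ≤ l := by exact_mod_cast hl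
      refine Real.Gamma_strictMonoOn_Ici.monotoneOn ?_ ?_ ?_
      · simp only [mem_Ici]; push_cast; linarith
      · simp only [mem_Ici]; push_cast; linarith
      · push_cast; linarith

theorem one_div_factorial_le_mul_unitBallVol {n : ℕ} (hn : 1 ≤ n) :
    1 / (((n - 1) / 2).factorial : ℝ) ≤ n * unitBallVol n := by
  have : Nonempty (Fin n) := ⟨⟨0, hn⟩⟩
  have hΓ0 : 0 < Real.Gamma ((n : ℝ) / 2 + 1) := Real.Gamma_pos_of_pos (by positivity)
  have hvol : unitBallVol n = Real.sqrt Real.pi ^ n / Real.Gamma ((n : ℝ) / 2 + 1) := by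
    rw [unitBallVol, EuclideanSpace.volume_ball]
    simp only [Fintype.card_fin, ENNReal.ofReal_one, one_pow, one_mul]
    exact ENNReal.toReal_ofReal (by positivity)
  set m := (n - 1) / 2 with hm
  have h1 : (1 : ℝ) ≤ Real.sqrt Real.pi ^ n :=
    one_le_pow₀ (Real.one_le_sqrt.mpr (by linarith [Real.pi_gt_three]))
  have h2 := Gamma_half_add_one_le hn
  have h3 : ((m : ℝ) + 1) ≤ n := by exact_mod_cast (by omega : m + 1 ≤ n)
  have hf : (0 : ℝ) < m.factorial := by exact_mod_cast m.factorial_pos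
  rw [hvol, ← mul_div_assoc, div_le_div_iff₀ hf hΓ0, one_mul]
  refine h2.trans ?_
  rw [Nat.factorial_succ]
  push_cast
  gcongr
  nlinarith

/-- All that the error bound needs from `Δ''`. As `2πρ ≥ 1`, the powers of `π`, `2` and `ρ` can be
dropped once a factor `2` is set aside: it comes from `2^((n+1)/2)` for even `n` and from `2 + 1/e`
for odd `n`. -/
theorem two_div_factorial_le_deltaConst_sq {n : ℕ} (hn : 1 ≤ n) :
    2 / (((n - 1) / 2).factorial : ℝ) ≤ deltaConst n ^ 2 := by
  have hvol := one_div_factorial_le_mul_unitBallVol hn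
  set m := (n - 1) / 2 with hm
  set v := (n : ℝ) * unitBallVol n with hv
  have hf : (0 : ℝ) < m.factorial := by exact_mod_cast m.factorial_pos
  have hv0 : 0 ≤ v := le_trans (by positivity) hvol
  have hρ := half_le_rho
  have hρ0 : 0 < rho := by linarith
  have hπ := Real.pi_gt_three
  have hsq : ∀ (x a : ℝ), 0 ≤ x → (x ^ a) ^ 2 = x ^ (2 * a) := fun x a hx => by
    rw [← Real.rpow_natCast, ← Real.rpow_mul hx, mul_comm]; norm_num
  have hv1 : (v ^ (1 / 2 : ℝ)) ^ 2 = v := by rw [hsq v _ hv0]; norm_num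
  have hbase : (1 : ℝ) ≤ Real.pi ^ m * 2 ^ m * rho ^ m := by
    rw [← mul_pow, ← mul_pow]
    exact one_le_pow₀ (by nlinarith)
  have hgoal : 2 / (m.factorial : ℝ) ≤ (Real.pi ^ m * 2 ^ m * rho ^ m) * (2 * v) := by
    calc 2 / (m.factorial : ℝ) = 1 * (2 * (1 / m.factorial)) := by ring
      _ ≤ _ := by gcongr
  refine hgoal.trans ?_
  have hmono : ∀ x a : ℝ, 1 ≤ x → (m : ℝ) ≤ a → x ^ m ≤ x ^ a := fun x a hx ha => by
    rw [← Real.rpow_natCast]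
    exact Real.rpow_le_rpow_of_exponent_le hx ha
  unfold deltaConst
  split_ifs with he
  · have hnm : (n : ℝ) = 2 * m + 2 := by
      have : n = 2 * m + 2 := by obtain ⟨l, rfl⟩ := he; omega
      rw [this]; push_cast; ring
    rw [mul_pow, mul_pow, mul_pow, hsq _ _ Real.pi_pos.le, hv1, hsq _ _ zero_le_two,
      hsq _ _ hρ0.le]
    have e1 : 2 * (((n : ℝ) - 2) / 4) = m := by rw [hnm]; ring
    have h1 := hmono Real.pi (2 * (((n : ℝ) - 1) / 4)) (by linarith) (by rw [hnm]; linarith)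
    have h2 : (2 : ℝ) ^ m * 2 ≤ 2 ^ (2 * (((n : ℝ) + 1) / 4)) := by
      rw [← pow_succ, ← Real.rpow_natCast]
      refine Real.rpow_le_rpow_of_exponent_le one_le_two ?_
      rw [hnm]; push_cast; linarith
    rw [e1, Real.rpow_natCast]
    calc (Real.pi ^ m * 2 ^ m * rho ^ m) * (2 * v) = Real.pi ^ m * v * (2 ^ m * 2) * rho ^ m := by
          ring
      _ ≤ _ := by gcongr
  · have hnm : (n : ℝ) = 2 * m + 1 := by
      have : n = 2 * m + 1 := by
        obtain ⟨l, rfl⟩ := Nat.not_even_iff_odd.mp he; omega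
      rw [this]; push_cast; ring
    have he0 : 0 < 1 / Real.exp 1 := by positivity
    rw [mul_pow, mul_pow, mul_pow, mul_pow, hsq _ _ Real.pi_pos.le, hv1, hsq 2 _ zero_le_two,
      hsq _ _ hρ0.le, hsq (2 + 1 / Real.exp 1) _ (by linarith)]
    have e1 : 2 * (((n : ℝ) - 1) / 4) = m := by rw [hnm]; ring
    have h2 := hmono 2 (2 * ((n : ℝ) / 4)) one_le_two (by rw [hnm]; linarith)
    have e3 : (2 * (1 / 2 : ℝ)) = 1 := by norm_num
    rw [e1, Real.rpow_natCast, Real.rpow_natCast, e3, Real.rpow_one]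
    calc (Real.pi ^ m * 2 ^ m * rho ^ m) * (2 * v) = Real.pi ^ m * v * 2 * 2 ^ m * rho ^ m := by
          ring
      _ ≤ _ := by gcongr; linarith

theorem deltaConst_nonneg (n : ℕ) : 0 ≤ deltaConst n := by
  have hρ0 : 0 ≤ rho := by linarith [half_le_rho]
  have hv : 0 ≤ unitBallVol n := ENNReal.toReal_nonneg
  unfold deltaConst
  split_ifs <;> positivity

/-- Exposes the fourth power of the base `A = √(βn) b₀ e^(2nγₙ)` of the error bound. The number is
`324 = 27 · 4 · 3`, with `ρ² e² = 3`. -/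
theorem bigC_eq (n : ℕ) {β : ℝ} (hβ : 0 < β) {b₀ : ℝ} (hb₀ : 0 < b₀) :
    bigC n β b₀ = 324 * Real.exp 1 ^ 2 *
      (Real.sqrt (β * n) * b₀ * Real.exp (2 * n * gam n)) ^ 4 * gam n / b₀ := by
  have hρ : 0 ≤ rho := by linarith [half_le_rho]
  have h1 : ((3 : ℝ) ^ (3 / 4 : ℝ)) ^ 4 = 27 := by
    rw [← Real.rpow_natCast, ← Real.rpow_mul (by norm_num)]
    norm_num
  have h2 : ∀ x : ℝ, 0 ≤ x → Real.sqrt x ^ 4 = x ^ 2 := fun x hx => by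
    rw [show 4 = 2 * 2 by norm_num, pow_mul, Real.sq_sqrt hx]
  have h3 : rho ^ 2 * Real.exp 1 ^ 2 = 3 := by
    rw [rho, div_pow, Real.sq_sqrt (by norm_num), div_mul_cancel₀ _ (by positivity)]
  rw [bigC, eq_div_iff hb₀.ne']
  simp only [mul_pow]
  rw [h1, h2 _ (by positivity), h2 _ (by positivity), h2 _ (by positivity)]
  linear_combination (27 * Real.exp 1 ^ 2 * 4 * β ^ 2 * (n : ℝ) ^ 2 *
    Real.exp (2 * n * gam n) ^ 4 * b₀ ^ 4 * gam n) * h3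

theorem deltaN_pos_and_le {n : ℕ} (hn : 1 ≤ n) {b₀ : ℝ} (hb₀ : 0 < b₀) :
    0 < deltaN n b₀ ∧ deltaN n b₀ * (2 * gam n) ≤ b₀ ∧
      deltaN n b₀ * (2 * gam n) * (2 * ((n - 1) / 2 : ℕ)) ≤ b₀ := by
  have hγ : (0 : ℝ) < gam n := by
    have := two_le_gam hn
    exact_mod_cast (by omega : 0 < gam n)
  -- The three definitions of `δₙ` are `a = 1`, `n - 1` and `n - 2`, each at least `2⌊(n - 1)/2⌋`.
  have key : ∀ a : ℝ, 1 ≤ a → ((2 * ((n - 1) / 2) : ℕ) : ℝ) ≤ a →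
      0 < b₀ / (2 * gam n * a) ∧ b₀ / (2 * gam n * a) * (2 * gam n) ≤ b₀ ∧
      b₀ / (2 * gam n * a) * (2 * gam n) * (2 * ((n - 1) / 2 : ℕ)) ≤ b₀ := fun a ha hma => by
    have ha0 : 0 < a := by linarith
    have h1 : b₀ / (2 * gam n * a) * (2 * gam n) = b₀ / a := by field_simp
    rw [h1]
    refine ⟨by positivity, div_le_self hb₀.le ha, ?_⟩
    rw [div_mul_eq_mul_div, div_le_iff₀ ha0]
    push_cast at hma ⊢
    gcongr
  unfold deltaN
  split_ifs with h12 hodd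
  · have h := key 1 le_rfl (by exact_mod_cast (by omega : 2 * ((n - 1) / 2) ≤ 1))
    rwa [mul_one] at h
  · have h3 : 3 ≤ n := by omega
    have h3' : (3 : ℝ) ≤ n := by exact_mod_cast h3
    refine key _ (by linarith) ?_
    have : (2 * ((n - 1) / 2)) + 1 ≤ n := by omega
    have h5 : ((2 * ((n - 1) / 2) : ℕ) : ℝ) + 1 ≤ n := by exact_mod_cast this
    linarith
  · have h3 : 3 ≤ n := by omega
    have h3' : (3 : ℝ) ≤ n := by exact_mod_cast h3
    refine key _ (by linarith) ?_
    obtain ⟨l, hl⟩ := Nat.not_odd_iff_even.mp hodd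
    have : (2 * ((n - 1) / 2)) + 2 ≤ n := by omega
    have h5 : ((2 * ((n - 1) / 2) : ℕ) : ℝ) + 2 ≤ n := by exact_mod_cast this
    linarith

theorem bigC_pos {n : ℕ} (hn : 1 ≤ n) {β b₀ : ℝ} (hβ : 0 < β) (hb₀ : 0 < b₀) :
    0 < bigC n β b₀ := by
  have hγ : (0 : ℝ) < gam n := by
    have := two_le_gam hn
    exact_mod_cast (by omega : 0 < gam n)
  have hn' : (0 : ℝ) < n := by exact_mod_cast hn
  rw [bigC_eq n hβ hb₀]
  positivity

/-- The exponential decay estimate behind the error bound. -/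
theorem four_mul_pow_div_sqrt_factorial_le {n k : ℕ} (hn : 1 ≤ n) (hk : 1 ≤ k)
    (hm : 2 * ((n - 1) / 2) ≤ k) {A K q : ℝ} (hA : 0 ≤ A) (hK : K / 2 ≤ k) (hq0 : 0 < q)
    (hq1 : q ≤ 1) (hAq : 324 * Real.exp 1 ^ 2 * A ^ 4 = q * K) :
    4 * (A ^ k / Real.sqrt k.factorial) ≤ deltaConst n * q ^ (K / 8) := by
  have hΔ := deltaConst_nonneg n
  have hΔ2 := two_div_factorial_le_deltaConst_sq hn
  set m := (n - 1) / 2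
  have hmf : (0 : ℝ) < m.factorial := by exact_mod_cast m.factorial_pos
  have hkf : (0 : ℝ) < k.factorial := by exact_mod_cast k.factorial_pos
  have hk1 : (1 : ℝ) ≤ k := by exact_mod_cast hk
  have hexp : q ^ ((k : ℝ) / 4) ≤ q ^ (K / 8) :=
    Real.rpow_le_rpow_of_exponent_ge hq0 hq1 (by linarith)
  refine le_trans ?_ (mul_le_mul_of_nonneg_left hexp hΔ)
  refine (pow_le_pow_iff_left₀ (by positivity) (by positivity) (four_ne_zero)).mp ?_
  have e1 : (q ^ ((k : ℝ) / 4)) ^ 4 = q ^ k := by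
    rw [← Real.rpow_natCast, ← Real.rpow_mul hq0.le, ← Real.rpow_natCast]
    congr 1
    push_cast
    ring
  have e2 : Real.sqrt k.factorial ^ 4 = (k.factorial : ℝ) ^ 2 := by
    rw [show 4 = 2 * 2 by norm_num, pow_mul, Real.sq_sqrt hkf.le]
  rw [mul_pow, mul_pow, div_pow, e1, e2, ← pow_mul, mul_comm k 4, pow_mul]
  have hE := Real.exp_pos 1
  have hE1 : (2 : ℝ) ≤ Real.exp 1 := by linarith [Real.exp_one_gt_d9]
  -- Uses `K ≤ 2k`. With `k^k ≤ k! e^k`, one of the two factorials cancels and the other absorbs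
  -- `(m!)²`.
  have hA4 : A ^ 4 ≤ q * (k / (162 * Real.exp 1 ^ 2)) := by
    rw [mul_div_assoc', le_div_iff₀ (by positivity)]
    nlinarith
  have h1 : (A ^ 4) ^ k ≤ q ^ k * ((k : ℝ) ^ k / (162 * Real.exp 1 ^ 2) ^ k) := by
    rw [← div_pow, ← mul_pow]
    gcongr
  have h2 : (k : ℝ) ^ k ≤ k.factorial * Real.exp 1 ^ k := by
    have := Real.pow_div_factorial_le_exp (k : ℝ) (Nat.cast_nonneg k) k
    rw [div_le_iff₀ hkf] at this
    rw [← Real.exp_nat_mul, mul_one, mul_comm]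
    exact this
  have h3 : (m.factorial : ℝ) ^ 2 ≤ k.factorial := by
    have h4 : m.factorial * m.factorial ≤ (m + m).factorial :=
      Nat.le_of_dvd (Nat.factorial_pos _) (Nat.factorial_mul_factorial_dvd_factorial_add m m)
    have h5 : (m + m).factorial ≤ k.factorial := Nat.factorial_le (by omega)
    rw [sq]
    exact_mod_cast h4.trans h5
  have h6 : 64 / (162 * Real.exp 1) ^ k ≤ (1 : ℝ) := by
    rw [div_le_one (by positivity)]
    calc (64 : ℝ) ≤ 162 * Real.exp 1 := by linarith
      _ ≤ _ := le_self_pow₀ (by linarith) (by omega)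
  have h7 : (4 : ℝ) / (m.factorial : ℝ) ^ 2 ≤ deltaConst n ^ 4 := by
    calc (4 : ℝ) / (m.factorial : ℝ) ^ 2 = (2 / m.factorial) ^ 2 := by rw [div_pow]; norm_num
      _ ≤ (deltaConst n ^ 2) ^ 2 := by gcongr
      _ = _ := by ring
  calc 4 ^ 4 * ((A ^ 4) ^ k / (k.factorial : ℝ) ^ 2)
      ≤ 4 ^ 4 * ((q ^ k * ((k.factorial * Real.exp 1 ^ k) / (162 * Real.exp 1 ^ 2) ^ k)) /
          (k.factorial : ℝ) ^ 2) := by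
        gcongr
        exact h1.trans (by gcongr)
    _ = 4 * (64 / (162 * Real.exp 1) ^ k) * q ^ k / k.factorial := by
        rw [mul_pow 162 (Real.exp 1 ^ 2), mul_pow 162 (Real.exp 1), ← pow_mul, mul_comm 2 k,
          pow_mul]
        field_simp
        ring
    _ ≤ 4 * 1 * q ^ k / (m.factorial : ℝ) ^ 2 := by gcongr
    _ = 4 / (m.factorial : ℝ) ^ 2 * q ^ k := by ring
    _ ≤ deltaConst n ^ 4 * q ^ k := by gcongr

/-- The pointwise error of a spline, once the centres are dense in a ball near the point. -/
theorem norm_sub_spline_le {n : ℕ} (hn : 1 ≤ n) {β b₀ : ℝ} (hβ : 0 < β) (hb₀ : 0 < b₀)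
    {X : Set (EuclideanSpace ℝ (Fin n))} {f s : EuclideanSpace ℝ (Fin n) → ℂ}
    (hf : MemNative (gaussian n β) f) (hs : IsSpline (gaussian n β) X f s) {k : ℕ} (hk : 1 ≤ k)
    {c x : EuclideanSpace ℝ (Fin n)} {d : ℝ} (hd : d * (gam n * k) ≤ b₀ / 2)
    (hX : ∀ z ∈ Metric.closedBall c (b₀ / 2), ∃ y ∈ X, dist z y < d)
    (hx : dist x c ≤ Real.sqrt n * (b₀ / 2)) :
    ‖f x - s x‖ ≤ 4 * ((Real.sqrt (β * n) * b₀ * Real.exp (2 * n * gam n)) ^ k /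
      Real.sqrt k.factorial) * nativeNorm (gaussian n β) f := by
  classical
  obtain ⟨Y, σ, hYX, hσ, hσΛ⟩ := exists_reproduction hn hk (half_pos hb₀) hd hX hx
  have hfs : ∀ y ∈ Y, f y - s y = 0 := fun y hy => by
    have hyX : y ∈ X := (hYX (Finset.mem_coe.mpr hy)).1
    rcases hs with ⟨_, _, _, _, h⟩ | ⟨_, h, _⟩ <;> rw [h hyX, sub_self]
  set T := insert x Y with hT
  -- Evaluation at `x` minus the reproduction formula. Indicators are used because `x` may itself
  -- belong to `Y`.
  set τ : EuclideanSpace ℝ (Fin n) → ℝ := fun a =>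
    (if a = x then 1 else 0) - (if a ∈ Y then σ a else 0) with hτ
  have hYT : T ∩ Y = Y := Finset.inter_eq_right.mpr (Finset.subset_insert x Y)
  have hxT : x ∈ T := Finset.mem_insert_self x Y
  have hτsum : ∀ g : EuclideanSpace ℝ (Fin n) → ℝ,
      ∑ a ∈ T, τ a * g a = g x - ∑ y ∈ Y, σ y * g y := fun g => by
    simp only [hτ, sub_mul, Finset.sum_sub_distrib, ite_mul, zero_mul, one_mul]
    rw [Finset.sum_ite_mem, hYT, Finset.sum_ite_eq' T x, if_pos hxT]
  have hτsumC : ∑ a ∈ T, (τ a : ℂ) * (f a - s a) = f x - s x := by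
    have h1 : ∀ a ∈ T, (τ a : ℂ) * (f a - s a) = if a = x then f a - s a else 0 := fun a _ => by
      by_cases haY : a ∈ Y
      · rw [hfs a haY]; simp
      · simp only [hτ, if_neg haY]; split_ifs <;> simp
    rw [Finset.sum_congr rfl h1, Finset.sum_ite_eq' T x, if_pos hxT]
  have hann : ∀ p ∈ linePoly (EuclideanSpace ℝ (Fin n)) k, ∑ a ∈ T, τ a * p a = 0 :=
    fun p hp => by rw [hτsum, ← hσ p hp, sub_self]
  set Λ := Real.exp (2 * n * gam n * k) with hΛ
  have hΛ1 : 1 ≤ Λ := Real.one_le_exp (by positivity)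
  have hτabs : ∑ a ∈ T, |τ a| ≤ 2 * Λ := by
    have h1 : ∑ a ∈ T, |τ a| ≤ ∑ a ∈ T, ((if a = x then 1 else 0) + if a ∈ Y then |σ a| else 0) := by
      refine Finset.sum_le_sum fun a _ => ?_
      refine (abs_sub _ _).trans (le_of_eq ?_)
      congr 1 <;> split_ifs <;> simp
    rw [Finset.sum_add_distrib, Finset.sum_ite_eq' T x, if_pos hxT, Finset.sum_ite_mem, hYT] at h1
    linarith
  have hn1 : 1 ≤ Real.sqrt n := Real.one_le_sqrt.mpr (by exact_mod_cast hn)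
  have hTc : ∀ a ∈ T, dist a c ≤ Real.sqrt n * (b₀ / 2) := fun a ha => by
    rcases Finset.mem_insert.mp ha with rfl | ha
    · exact hx
    · have h1 : dist a c ≤ b₀ / 2 := (hYX (Finset.mem_coe.mpr ha)).2
      nlinarith
  have hdiam : ∀ a ∈ T, ∀ b ∈ T, ‖a - b‖ ≤ Real.sqrt n * b₀ := fun a ha b hb => by
    rw [← dist_eq_norm]
    have := dist_triangle_right a b c
    linarith [hTc a ha, hTc b hb]
  have hquad : (∑ a ∈ T, ∑ b ∈ T, (τ a : ℂ) * conj (τ b : ℂ) * gaussian n β (a - b)).re ≤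
      (2 * ((Real.sqrt (β * n) * b₀ * Real.exp (2 * n * gam n)) ^ k /
        Real.sqrt k.factorial)) ^ 2 := by
    have h1 : ∑ a ∈ T, ∑ b ∈ T, (τ a : ℂ) * conj (τ b : ℂ) * gaussian n β (a - b) =
        ((∑ a ∈ T, ∑ b ∈ T, τ a * τ b * Real.exp (-β * ‖a - b‖ ^ 2) : ℝ) : ℂ) := by
      push_cast
      refine Finset.sum_congr rfl fun a _ => Finset.sum_congr rfl fun b _ => ?_
      rw [Complex.conj_ofReal, gaussian]
      push_cast
      rfl
    rw [h1, Complex.ofReal_re]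
    refine (sum_sum_gaussian_le hann hβ.le hdiam).trans ?_
    have h2 : (0 : ℝ) ≤ ∑ a ∈ T, |τ a| := Finset.sum_nonneg fun _ _ => abs_nonneg _
    have h3 : Real.exp (2 * n * gam n) ^ k = Λ := by
      rw [hΛ, ← Real.exp_nat_mul]; ring_nf
    have h4 : (β * (Real.sqrt n * b₀) ^ 2) ^ k = ((Real.sqrt (β * n) * b₀) ^ k) ^ 2 := by
      rw [← pow_mul, mul_comm k 2, pow_mul, mul_pow (Real.sqrt n),
        mul_pow (Real.sqrt (β * n)), Real.sq_sqrt (Nat.cast_nonneg n), Real.sq_sqrt (by positivity)]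
      ring
    rw [h4, mul_pow _ (Real.exp _) k, h3]
    calc (∑ a ∈ T, |τ a|) ^ 2 * (((Real.sqrt (β * n) * b₀) ^ k) ^ 2 / k.factorial)
        ≤ (2 * Λ) ^ 2 * (((Real.sqrt (β * n) * b₀) ^ k) ^ 2 / k.factorial) := by gcongr
      _ = _ := by
        rw [mul_pow 2 (_ / _), div_pow, Real.sq_sqrt (Nat.cast_nonneg _)]; ring
  have hmain := norm_sum_mul_sub_spline_le hβ hf hs T fun a => (τ a : ℂ)
  rw [hτsumC] at hmain
  have hsqrt := Real.sqrt_le_sqrt hquad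
  rw [Real.sqrt_sq (by positivity)] at hsqrt
  have hN := nativeNorm_nonneg (gaussian n β) f
  calc ‖f x - s x‖ ≤ _ := hmain
    _ ≤ 2 * nativeNorm (gaussian n β) f *
        (2 * ((Real.sqrt (β * n) * b₀ * Real.exp (2 * n * gam n)) ^ k /
          Real.sqrt k.factorial)) := by gcongr
    _ = _ := by ring

end GaussInterp

/-! ### Choice of the degree and conclusion -/

theorem mainTheorem2 (n : ℕ) (hn : 1 ≤ n) (β b₀ : ℝ) (hβ : 0 < β) (hb₀ : 0 < b₀) :
    0 < GaussInterp.dist0 n β b₀ ∧ 0 < GaussInterp.smallC' n b₀ ∧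
    0 < GaussInterp.bigC' n β b₀ ∧
    ∀ Ω X : Set (EuclideanSpace ℝ (Fin n)), GaussInterp.IsUnionOfCubes b₀ Ω →
    ∀ f s : EuclideanSpace ℝ (Fin n) → ℂ,
      GaussInterp.MemNative (GaussInterp.gaussian n β) f →
      GaussInterp.IsSpline (GaussInterp.gaussian n β) X f s →
    ∀ (b : ℝ) (E : Set (EuclideanSpace ℝ (Fin n))),
      b₀ ≤ b → GaussInterp.IsCube b E → E ⊆ Ω →
    ∀ d : ℝ,
      (GaussInterp.fillDist Ω X = ENNReal.ofReal d ∨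
        GaussInterp.fillDist E X = ENNReal.ofReal d) →
      0 < d → d ≤ GaussInterp.dist0 n β b₀ →
    ∀ x ∈ E,
      ‖f x - s x‖ ≤ GaussInterp.deltaConst n *
        (GaussInterp.bigC' n β b₀ * d) ^ (GaussInterp.smallC' n b₀ / d) *
        GaussInterp.nativeNorm (GaussInterp.gaussian n β) f := by
  open GaussInterp in
  have hγ : (0 : ℝ) < gam n := by
    have := two_le_gam hn
    exact_mod_cast (by omega : 0 < gam n)
  have hC := bigC_pos hn hβ hb₀
  obtain ⟨hδ0, hδ1, hδ2⟩ := deltaN_pos_and_le hn hb₀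
  refine ⟨half_pos (lt_min (by positivity) hδ0), half_pos (by unfold smallC; positivity),
    mul_pos two_pos hC, ?_⟩
  intro Ω X _ f s hf hs b E hb hE hEΩ d hfill hd hdd x hx
  have hdC : 2 * d ≤ 1 / bigC n β b₀ := by
    have h1 : dist0 n β b₀ ≤ 1 / bigC n β b₀ / 2 := by
      unfold dist0 delta0
      gcongr
      exact min_le_left _ _
    linarith
  have hdN : 2 * d ≤ deltaN n b₀ := by
    have h1 : dist0 n β b₀ ≤ deltaN n b₀ / 2 := by
      unfold dist0 delta0
      gcongr
      exact min_le_right _ _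
    linarith
  set K := b₀ / (2 * gam n * d) with hK
  have hKd : K * (2 * gam n * d) = b₀ := div_mul_cancel₀ _ (by positivity)
  have hK2 : 2 ≤ K := by
    rw [hK, le_div_iff₀ (by positivity)]
    nlinarith
  have hKm : ((2 * ((n - 1) / 2) : ℕ) : ℝ) ≤ K / 2 := by
    rw [le_div_iff₀ two_pos, hK, le_div_iff₀ (by positivity)]
    push_cast
    have h1 : 2 * d * (2 * gam n) * (2 * ((n - 1) / 2 : ℕ)) ≤
        deltaN n b₀ * (2 * gam n) * (2 * ((n - 1) / 2 : ℕ)) := by gcongr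
    linarith
  -- As `K ≥ 2`, this gives `K / 2 ≤ k < K`. The strict upper bound lets the mesh grow from `d` to
  -- `b₀ / (2γₙk) > d`, needed because the infimum in the fill distance may not be attained. The
  -- lower bound yields the exponent `K / 8 = c' / d`.
  set k := ⌈K / 2⌉₊ with hk
  have hkK : K / 2 ≤ k := Nat.le_ceil _
  have hkK' : (k : ℝ) < K := by
    have := Nat.ceil_lt_add_one (a := K / 2) (by linarith)
    linarith
  have hk1 : 1 ≤ k := Nat.one_le_iff_ne_zero.mpr fun h => by
    rw [h, Nat.cast_zero] at hkK
    linarith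
  have hk0 : (0 : ℝ) < k := by exact_mod_cast hk1
  obtain ⟨c, hxc, hcE⟩ := hE.exists_center hb₀ hb hx
  have hdd' : d < b₀ / (2 * gam n * k) := by
    rw [lt_div_iff₀ (by positivity)]
    calc d * (2 * gam n * k) < d * (2 * gam n * K) := by gcongr
      _ = b₀ := by linarith
  have hdense : ∀ z ∈ Metric.closedBall c (b₀ / 2), ∃ y ∈ X, dist z y < b₀ / (2 * gam n * k) :=
    fun z hz => by
      rcases hfill with h | h
      · exact exists_dist_lt_of_fillDist h hd hdd' (hEΩ (hcE hz))
      · exact exists_dist_lt_of_fillDist h hd hdd' (hcE hz)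
  have herr := norm_sub_spline_le hn hβ hb₀ hf hs hk1 (d := b₀ / (2 * gam n * k))
    (le_of_eq (by field_simp)) hdense hxc
  have hq1 : bigC' n β b₀ * d ≤ 1 := by
    rw [le_div_iff₀ hC] at hdC
    unfold bigC'
    linarith
  have hAq : 324 * Real.exp 1 ^ 2 *
      (Real.sqrt (β * n) * b₀ * Real.exp (2 * n * gam n)) ^ 4 = bigC' n β b₀ * d * K := by
    rw [bigC', bigC_eq n hβ hb₀, hK]
    field_simp
  have hexp : smallC' n b₀ / d = K / 8 := by
    rw [smallC', smallC, hK]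
    field_simp
  rw [hexp]
  refine herr.trans (mul_le_mul_of_nonneg_right ?_ (nativeNorm_nonneg _ _))
  exact four_mul_pow_div_sqrt_factorial_le hn hk1 (by exact_mod_cast hKm.trans hkK) (by positivity)
    hkK (mul_pos (mul_pos two_pos hC) hd) hq1 hAq
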